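/- Identify $\mathbb{R}^2$ with $\mathbb{C}$. Call $D\subset\mathbb{C}$ Jordan measurable if it is bounded and its boundary has Lebesgue measure $0$. A locally finite set $\mathcal{P}\subset\mathbb{C}$ has density $\theta(\mathcal{P})$ if $\lim_{T\to\infty}\#(\mathcal{P}\cap TD)/\mathrm{vol}(TD)=\theta(\mathcal{P})$ for every Jordan measurable $D$ with $\mathrm{vol}(D)>0$. Let $\widehat{\mathcal{P}}=\{x\in\mathcal{P}: tx\notin\mathcal{P}\text{ for all }t\in(0,1)\}$ be the set of visible points of $\mathcal{P}$. A set $C\subset(1,\infty)$ is a set of occlusion quotients for $\mathcal{P}$ if for every $x\in\mathcal{P}\setminus\widehat{\mathcal{P}}$ there is $c\in C$ with $x/c\in\mathcal{P}$. Let $\zeta=e^{2\pi i/8}$, let $\sigma$ be the automorphism of $\mathbb{Q}(\zeta)$ with $\sigma(\zeta)=\zeta^3$, let $K=\mathbb{Q}(\sqrt2)$ with Dedekind zeta function $\zeta_K$, and let $\lambda=1+\sqrt2$. Let $\mathbb{P}$ be the set of prime elements $\pi$ of $\mathcal{O}_K=\mathbb{Z}[\sqrt2]$ with $1<\pi<\lambda$,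 and let $C=\mathbb{P}\cup\{\lambda\}$. For $\mathcal{W}\subset\mathbb{C}$ put $\mathcal{A}_{\mathcal{W}}=\{x\in\mathbb{Z}[\zeta]:\sigma(x)\in\mathcal{W}\}$. **Theorem.** Let $\mathcal{W}\subset\mathbb{C}$ be Jordan measurable and star-shaped with respect to $0$, with $-\mathcal{W}\subset\sqrt2\,\mathcal{W}$. Then $C$ is a set of occlusion quotients for $\mathcal{A}_{\mathcal{W}}$; the densities of $\mathcal{A}_{\mathcal{W}}$, of $\widehat{\mathcal{A}_{\mathcal{W}}}$, and of $\mathcal{A}_{\mathcal{W}}\cap\bigcap_{c\in F}c\mathcal{A}_{\mathcal{W}}$ for every finite $F\subset C$ all exist; and $$\theta(\widehat{\mathcal{A}_{\mathcal{W}}})=\sum_{\substack{F\subset C\\ \#F<\infty}}(-1)^{\#F}\,\theta\Big(\mathcal{A}_{\mathcal{W}}\cap\bigcap_{c\in F}c\mathcal{A}_{\mathcal{W}}\Big)=\frac{2|\sigma(\lambda)|\,\theta(\mathcal{A}_{\mathcal{W}})}{\zeta_K(2)},$$ where the sum converges unconditionally. Moreover, if $\mathcal{W}$ is the open regular octagon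 of side length $1$ centred at $0$ whose sides are perpendicularly bisected by the coordinate axes (so that $\mathcal{A}_{\mathcal{W}}$ is the Ammann–Beenker point set), then $\theta(\widehat{\mathcal{A}_{\mathcal{W}}})$ exists and equals $1/\zeta_K(2)$. -/

import Mathlib

open Filter Topology MeasureTheory
open scoped Pointwise

noncomputable section

/-! Throughout, the plane is identified with `ℂ`. -/

/-- A set in the plane is Jordan measurable if it is bounded and its boundary has measure zero. -/
def JordanMeasurable (D : Set ℂ) : Prop :=
  Bornology.IsBounded D ∧ volume (frontier D) = 0

/-- Every bounded region contains only finitely many points of `P`. -/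
def LocallyFinitePointSet (P : Set ℂ) : Prop :=
  ∀ B : Set ℂ, Bornology.IsBounded B → (P ∩ B).Finite

/-- The locally finite point set `P` has asymptotic density `θ`. -/
def HasDensity (P : Set ℂ) (θ : ℝ) : Prop :=
  LocallyFinitePointSet P ∧
    ∀ D : Set ℂ, JordanMeasurable D → 0 < volume D →
      Tendsto (fun T : ℝ => ((P ∩ T • D).ncard : ℝ) / volume.real (T • D)) atTop (𝓝 θ)

/-- The points of `P` that are visible from the origin. -/
def visiblePoints (P : Set ℂ) : Set ℂ :=
  {x | x ∈ P ∧ ∀ t : ℝ, 0 < t → t < 1 → t • x ∉ P}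

/-- `C ⊆ (1, ∞)` is a set of occlusion quotients for `P`. -/
def IsOcclusionQuotients (C : Set ℝ) (P : Set ℂ) : Prop :=
  (∀ c ∈ C, 1 < c) ∧ ∀ x ∈ P \ visiblePoints P, ∃ c ∈ C, c⁻¹ • x ∈ P

/-! ### The field `ℚ(ζ)`, `ζ = exp (2πi/8)`, and its automorphism `σ` with `σ ζ = ζ ^ 3` -/

/-- `ζ = exp (2πi/8)` as a complex number. -/
def zeta8 : ℂ := Complex.exp (2 * Real.pi * Complex.I / (8 : ℕ))

theorem zeta8_isPrimitiveRoot : IsPrimitiveRoot zeta8 8 :=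
  Complex.isPrimitiveRoot_exp 8 (by norm_num)

/-- The cyclotomic field `ℚ(ζ)` as a subfield of `ℂ`. -/
abbrev QZeta : IntermediateField ℚ ℂ := IntermediateField.adjoin ℚ {zeta8}

/-- `ζ` as an element of `ℚ(ζ)`. -/
def zetaGen : QZeta := IntermediateField.AdjoinSimple.gen ℚ zeta8

theorem zetaGen_isPrimitiveRoot : IsPrimitiveRoot zetaGen 8 :=
  IsPrimitiveRoot.of_map_of_injective (f := algebraMap QZeta ℂ)
    (by simpa [zetaGen] using zeta8_isPrimitiveRoot) (algebraMap QZeta ℂ).injective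

theorem zetaGen_pow_three_isPrimitiveRoot : IsPrimitiveRoot (zetaGen ^ 3) 8 :=
  zetaGen_isPrimitiveRoot.pow_of_coprime 3 (by norm_num)

instance instQZetaCyclotomic : IsCyclotomicExtension {8} ℚ QZeta := by
  change IsCyclotomicExtension {8} ℚ QZeta.toSubalgebra
  have hint : IsIntegral ℤ zeta8 := zeta8_isPrimitiveRoot.isIntegral (by norm_num)
  have halg : IsAlgebraic ℚ zeta8 := (hint.tower_top (A := ℚ)).isAlgebraic
  rw [IntermediateField.adjoin_simple_toSubalgebra_of_isAlgebraic halg]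
  exact zeta8_isPrimitiveRoot.adjoin_isCyclotomicExtension ℚ

/-- The automorphism `σ` of `ℚ(ζ)` determined by `σ ζ = ζ ^ 3`. -/
def sigma : QZeta ≃ₐ[ℚ] QZeta :=
  (zetaGen_isPrimitiveRoot.powerBasis ℚ).equivOfMinpoly
    (zetaGen_pow_three_isPrimitiveRoot.powerBasis ℚ) (by
      rw [IsPrimitiveRoot.powerBasis_gen, IsPrimitiveRoot.powerBasis_gen,
        ← Polynomial.cyclotomic_eq_minpoly_rat zetaGen_isPrimitiveRoot (by norm_num),
        ← Polynomial.cyclotomic_eq_minpoly_rat zetaGen_pow_three_isPrimitiveRoot (by norm_num)])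

theorem sigma_zetaGen : sigma zetaGen = zetaGen ^ 3 := by
  have h := (zetaGen_isPrimitiveRoot.powerBasis ℚ).equivOfMinpoly_gen
    (zetaGen_pow_three_isPrimitiveRoot.powerBasis ℚ) (by
      rw [IsPrimitiveRoot.powerBasis_gen, IsPrimitiveRoot.powerBasis_gen,
        ← Polynomial.cyclotomic_eq_minpoly_rat zetaGen_isPrimitiveRoot (by norm_num),
        ← Polynomial.cyclotomic_eq_minpoly_rat zetaGen_pow_three_isPrimitiveRoot (by norm_num)])
  simpa [sigma] using h

/-- The ring `ℤ[ζ]` inside `ℚ(ζ)`. -/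
def ZZeta : Subalgebra ℤ QZeta := Algebra.adjoin ℤ {zetaGen}

/-- The set `A_W = {x ∈ ℤ[ζ] | σ x ∈ W}` as a subset of the plane. -/
def ASet (W : Set ℂ) : Set ℂ :=
  (fun x : QZeta => (x : ℂ)) '' {x : QZeta | x ∈ ZZeta ∧ ((sigma x : QZeta) : ℂ) ∈ W}

/-! ### The field `K = ℚ(√2)` -/

/-- The real quadratic field `K = ℚ(√2)`. -/
abbrev QSqrtTwo : IntermediateField ℚ ℝ := IntermediateField.adjoin ℚ {√2}

instance instQSqrtTwoNumberField : NumberField QSqrtTwo where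
  to_charZero := inferInstance
  to_finiteDimensional := by
    apply IntermediateField.adjoin.finiteDimensional
    refine ⟨Polynomial.X ^ 2 - Polynomial.C 2, Polynomial.monic_X_pow_sub_C _ (by norm_num), ?_⟩
    simp

/-- The fundamental unit `λ = 1 + √2` of `K`, as a real number. -/
def lam : ℝ := 1 + √2

/-- `λ = 1 + ζ + ζ⁻¹`, regarded as an element of `ℚ(ζ)`; see `coe_lamZ`. -/
def lamZ : QZeta := 1 + zetaGen + zetaGen⁻¹

theorem zeta8_eq : zeta8 = (√2 / 2 : ℝ) + (√2 / 2 : ℝ) * Complex.I := by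
  have h : (2 * Real.pi * Complex.I / (8 : ℕ) : ℂ) = ((Real.pi / 4 : ℝ) : ℂ) * Complex.I := by
    push_cast; ring
  rw [zeta8, h, Complex.exp_mul_I, ← Complex.ofReal_cos, ← Complex.ofReal_sin,
    Real.cos_pi_div_four, Real.sin_pi_div_four]

theorem coe_lamZ : (lamZ : ℂ) = (lam : ℂ) := by
  have hs : √2 * √2 = 2 := Real.mul_self_sqrt (by norm_num)
  have hinv : zeta8⁻¹ = (√2 / 2 : ℝ) - (√2 / 2 : ℝ) * Complex.I := by
    apply inv_eq_of_mul_eq_one_right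
    rw [zeta8_eq]
    apply Complex.ext
    · simp
      nlinarith
    · simp
  have hz : ((zetaGen : QZeta) : ℂ) = zeta8 := by simp [zetaGen]
  have : (lamZ : ℂ) = 1 + zeta8 + zeta8⁻¹ := by simp [lamZ, hz]
  rw [this, hinv, zeta8_eq, lam]
  push_cast
  ring

theorem coe_sigma_lamZ : ((sigma lamZ : QZeta) : ℂ) = ((1 - √2 : ℝ) : ℂ) := by
  have h8 : zetaGen ^ 8 = 1 := zetaGen_isPrimitiveRoot.pow_eq_one
  have h0 : zetaGen ≠ 0 := zetaGen_isPrimitiveRoot.ne_zero (by norm_num)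
  have h4 : zetaGen ^ 4 = -1 := by
    have h1 : zetaGen ^ 4 ≠ 1 := zetaGen_isPrimitiveRoot.pow_ne_one_of_pos_of_lt
      (by norm_num) (by norm_num)
    have h2 : (zetaGen ^ 4 - 1) * (zetaGen ^ 4 + 1) = 0 := by linear_combination h8
    rcases mul_eq_zero.mp h2 with h | h
    · exact absurd (sub_eq_zero.mp h) h1
    · exact eq_neg_of_add_eq_zero_left h
  have h : sigma lamZ = 2 - lamZ := by
    simp only [lamZ, map_add, map_one, map_inv₀, sigma_zetaGen]
    field_simp
    linear_combination (zetaGen ^ 2 + 1) * h4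
  have hc : ((sigma lamZ : QZeta) : ℂ) = 2 - (lamZ : ℂ) := by
    rw [h]
    rfl
  rw [hc, coe_lamZ, lam]
  push_cast
  ring

/-- The primes `π` of `𝓞 K` with `1 < π < λ`, as real numbers. -/
def primesP : Set ℝ :=
  {x | ∃ p : NumberField.RingOfIntegers QSqrtTwo,
    Prime p ∧ ((p : QSqrtTwo) : ℝ) = x ∧ 1 < x ∧ x < lam}

/-- The set `C = ℙ ∪ {λ}`. -/
def quotC : Set ℝ := primesP ∪ {lam}

/-- The intersection of `P` with the dilates `c P` for `c ∈ F`. -/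
def multiIntersection {C : Set ℝ} (P : Set ℂ) (F : Finset C) : Set ℂ :=
  P ∩ ⋂ c ∈ F, (c : ℝ) • P

/-- The family of windows: Jordan measurable, star-shaped with respect to the origin,
with `-W ⊆ √2 W`. -/
def IsWindow (W : Set ℂ) : Prop :=
  JordanMeasurable W ∧ StarConvex ℝ 0 W ∧ -W ⊆ √2 • W

/-- The open regular octagon with side length `1` centred at the origin whose sides are
perpendicularly bisected by the coordinate axes: the regular octagon with unit normals `ζ ^ k`
and inradius `(1 + √2) / 2`, which is the inradius of a regular octagon of side `1`. -/
def octagon : Set ℂ :=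
  {z | ∀ k : Fin 8, (z * (starRingEnd ℂ) (zeta8 ^ (k : ℕ))).re < (1 + √2) / 2}

end

/-! Under `x ↦ (x, σ x)` the module `ℤ[ζ] = ℤ[√2] ⊕ ℤ[√2] ζ` becomes a lattice of covolume 4 in `ℂ ×
ℂ`, so `A_W` has density `vol(W) / 4` (`hasDensity_ASet`).

Let `x` and `t x` lie in `A_W` with `0 < t < 1` and `x ≠ 0`. As `ℤ[√2]` is principal, the reduced
denominator of `t` divides `x`. If it is not a unit, some `π ∈ ℙ` divides `x`, and `x / π` is in
`A_W`; if it is a unit, then `t ∈ ℤ[√2]`, and `x / λ` is in `A_W`. The window condition survives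
because the conjugate of an element of `(1, λ)` or of `(0, 1)` avoids a whole interval, and what
remains is what star-shape and `-W ⊆ √2 W` can absorb (`IsWindow.isOcclusionQuotients`).

So the visible points are `A_W` minus all `c A_W`, `c ∈ C`. The elements of `C` are pairwise
coprime, hence intersecting over a finite `F` multiplies the density by `∏ quotFactor c`, which is
`N(π)⁻²` for a prime and `λ⁻²` for `λ` (`hasDensity_multiIntersection`). Finite inclusion-exclusion
gives `∏ (1 - quotFactor c)`. The passage to infinitely many `c` rests on a bound for `A_W ∩ c A_W ∩
T D` by a constant times `T² N(c)⁻²`, uniform in `c` and `T` (`exists_ncard_inter_smul_le`). Sieving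
the sum of `N(I)⁻²` over ideals shows that the primes contribute `1 / ζ_K(2)`, and `1 - λ⁻² = 2 λ⁻¹
= 2 |σ λ|`. Expanding the same absolutely convergent product gives the sum over `F`. The octagon has
area `2 λ`. -/

/-! ### Arithmetic of `ℤ[√2]`: division, units, gaps between conjugates. -/

/-- The embedding of `ℤ[√2]` into `ℝ` with `√2 ↦ √2`. -/
noncomputable def emb : ℤ√2 →+* ℝ := Zsqrtd.lift ⟨√2, by norm_num⟩

/-- The embedding of `ℤ[√2]` into `ℝ` with `√2 ↦ -√2`. -/
noncomputable def embConj : ℤ√2 →+* ℝ := Zsqrtd.lift ⟨-√2, by norm_num⟩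

theorem emb_apply (x : ℤ√2) : emb x = x.re + x.im * √2 := by
  simp [emb, Zsqrtd.lift]

theorem embConj_apply (x : ℤ√2) : embConj x = x.re - x.im * √2 := by
  simp [embConj, Zsqrtd.lift, sub_eq_add_neg]

theorem emb_mul_embConj (x : ℤ√2) : emb x * embConj x = x.norm := by
  have h : √2 * √2 = 2 := Real.mul_self_sqrt (by norm_num)
  rw [emb_apply, embConj_apply, Zsqrtd.norm_def]
  push_cast
  linear_combination -(x.im : ℝ) ^ 2 * h

theorem emb_injective : Function.Injective emb :=
  Zsqrtd.lift_injective _ fun n hn => by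
    rcases le_or_gt |n| 1 with h | h
    · nlinarith [abs_mul_abs_self n, abs_nonneg n]
    · nlinarith [abs_mul_abs_self n]

theorem embConj_injective : Function.Injective embConj :=
  Zsqrtd.lift_injective _ fun n hn => by
    rcases le_or_gt |n| 1 with h | h
    · nlinarith [abs_mul_abs_self n, abs_nonneg n]
    · nlinarith [abs_mul_abs_self n]

instance : IsDomain (ℤ√2) := emb_injective.isDomain emb

theorem emb_eq_zero {x : ℤ√2} : emb x = 0 ↔ x = 0 := map_eq_zero_iff _ emb_injective

theorem embConj_eq_zero {x : ℤ√2} : embConj x = 0 ↔ x = 0 := map_eq_zero_iff _ embConj_injective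

theorem zsqrtd_norm_eq_zero {x : ℤ√2} : x.norm = 0 ↔ x = 0 := by
  have := emb_mul_embConj x
  constructor
  · intro h
    rw [h, Int.cast_zero, mul_eq_zero, emb_eq_zero, embConj_eq_zero, or_self] at this
    exact this
  · rintro rfl
    simp

theorem exists_two_mul_abs_sub_mul_le (r : ℤ) {n : ℤ} (hn : n ≠ 0) :
    ∃ q : ℤ, 2 * |r - q * n| ≤ |n| := by
  refine ⟨round ((r : ℚ) / n), ?_⟩
  have h := abs_sub_round ((r : ℚ) / n)
  have hn' : (n : ℚ) ≠ 0 := by exact_mod_cast hn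
  have h2 : ((r : ℚ) / n - round ((r : ℚ) / n)) * n = r - round ((r : ℚ) / n) * n := by
    field_simp
  have h3 : |((r : ℚ) - round ((r : ℚ) / n) * n)| ≤ 1 / 2 * |(n : ℚ)| := by
    rw [← h2, abs_mul]
    gcongr
  have h4 : 2 * |((r : ℚ) - round ((r : ℚ) / n) * n)| ≤ |(n : ℚ)| := by linarith
  exact_mod_cast h4

/-- Round both coordinates of `a / b = a b̄ / N(b)` to nearest integers. The error has coordinates
at most 1/2 in absolute value, so its norm `u² - 2 v²` lies in `[-1/2, 1/4]`. -/
theorem exists_abs_norm_sub_mul_lt (a : ℤ√2) {b : ℤ√2} (hb : b ≠ 0) :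
    ∃ q : ℤ√2, (a - b * q).norm.natAbs < b.norm.natAbs := by
  have hn : b.norm ≠ 0 := fun h => hb (zsqrtd_norm_eq_zero.mp h)
  obtain ⟨q1, h1⟩ := exists_two_mul_abs_sub_mul_le (a * star b).re hn
  obtain ⟨q2, h2⟩ := exists_two_mul_abs_sub_mul_le (a * star b).im hn
  refine ⟨⟨q1, q2⟩, ?_⟩
  have key : (a - b * ⟨q1, q2⟩).norm * b.norm =
      ((a * star b).re - q1 * b.norm) ^ 2 - 2 * ((a * star b).im - q2 * b.norm) ^ 2 := by
    have : (a - b * ⟨q1, q2⟩) * star b = a * star b - (b * star b) * ⟨q1, q2⟩ := by ring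
    rw [← Zsqrtd.norm_conj b, ← Zsqrtd.norm_mul, this, ← Zsqrtd.norm_eq_mul_conj, Zsqrtd.norm_conj,
      Zsqrtd.norm_def]
    simp only [Zsqrtd.re_sub, Zsqrtd.im_sub, Zsqrtd.re_mul, Zsqrtd.im_mul, Zsqrtd.re_intCast,
      Zsqrtd.im_intCast]
    ring
  zify
  have hpos : 0 < |b.norm| := abs_pos.mpr hn
  refine lt_of_mul_lt_mul_right ?_ hpos.le
  rw [← abs_mul, key]
  set u := (a * star b).re - q1 * b.norm
  set v := (a * star b).im - q2 * b.norm
  have hu : 4 * u ^ 2 ≤ |b.norm| ^ 2 := by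
    rw [← sq_abs u]; nlinarith [abs_nonneg u]
  have hv : 4 * v ^ 2 ≤ |b.norm| ^ 2 := by
    rw [← sq_abs v]; nlinarith [abs_nonneg v]
  rw [abs_lt]
  constructor <;> nlinarith [sq_nonneg u, sq_nonneg v]

/-- The ring `ℤ[√2]` is norm-Euclidean. -/
noncomputable abbrev zsqrtdEuclideanDomain : EuclideanDomain (ℤ√2) :=
  open Classical in
  { (inferInstance : CommRing (ℤ√2)), (inferInstance : Nontrivial (ℤ√2)) with
    quotient := fun a b => if hb : b = 0 then 0 else (exists_abs_norm_sub_mul_lt a hb).choose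
    remainder := fun a b =>
      a - b * if hb : b = 0 then 0 else (exists_abs_norm_sub_mul_lt a hb).choose
    quotient_zero := fun a => by simp
    quotient_mul_add_remainder_eq := fun a b => by ring
    r := fun a b => a.norm.natAbs < b.norm.natAbs
    r_wellFounded := (measure fun a : ℤ√2 => a.norm.natAbs).wf
    remainder_lt := fun a b hb => by
      simpa [hb] using (exists_abs_norm_sub_mul_lt a hb).choose_spec
    mul_left_not_lt := fun a b hb => by
      rw [not_lt, Zsqrtd.norm_mul, Int.natAbs_mul]
      exact Nat.le_mul_of_pos_right _
        (Int.natAbs_pos.mpr fun h => hb (zsqrtd_norm_eq_zero.mp h)) }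

instance : IsPrincipalIdealRing (ℤ√2) :=
  @EuclideanDomain.to_principal_ideal_domain _ zsqrtdEuclideanDomain

theorem sqrt_two_bounds : (1.414 : ℝ) < √2 ∧ √2 < 1.415 := by
  constructor
  · rw [Real.lt_sqrt] <;> norm_num
  · rw [Real.sqrt_lt'] <;> norm_num

theorem one_lt_lam : 1 < lam := by
  have := sqrt_two_bounds.1
  rw [lam]; linarith

/-- A conjugate in `(-√2, 1)` would leave only `√2` and `1 + √2` as candidates, and each sits on an
excluded endpoint. The two alternatives are exactly the divisors under which a window is stable, see
`IsWindow.inv_smul_mem`. -/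
theorem embConj_of_emb_mem_Ioo_one_lam {x : ℤ√2} (h1 : 1 < emb x) (h2 : emb x < lam) :
    1 ≤ embConj x ∨ embConj x ≤ -√2 := by
  obtain ⟨hs1, hs2⟩ := sqrt_two_bounds
  by_contra! h
  obtain ⟨h3, h4⟩ := h
  rw [embConj_apply] at h3 h4
  rw [emb_apply] at h1 h2
  rw [lam] at h2
  have hy1 : (0 : ℝ) < x.im := by nlinarith
  have hy2 : (x.im : ℝ) < 2 := by nlinarith
  have hx1 : (-1 : ℝ) < x.re := by nlinarith
  have hx2 : (x.re : ℝ) < 2 := by nlinarith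
  norm_cast at hy1 hy2
  have hx1' : -1 < x.re := by exact_mod_cast hx1
  have hx2' : x.re < 2 := by exact_mod_cast hx2
  have hy : x.im = 1 := by omega
  have hx : x.re = 0 ∨ x.re = 1 := by omega
  rcases hx with hx | hx <;> rw [hx, hy] at h2 h4 <;> push_cast at h2 h4 <;> linarith

/-- This is the gap needed when the ratio `t` of two collinear points is itself in `ℤ[√2]`: after
division by `-lam` the bounds become `≤ -√2` and `≥ 1`. The proof is a finite check of the few
integer coordinates allowed. -/
theorem embConj_of_emb_mem_Ioo_zero_one {x : ℤ√2} (h1 : 0 < emb x) (h2 : emb x < 1) :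
    √2 * lam ≤ embConj x ∨ embConj x ≤ -lam := by
  obtain ⟨hs1, hs2⟩ := sqrt_two_bounds
  have hs : √2 * √2 = 2 := Real.mul_self_sqrt (by norm_num)
  by_contra! h
  obtain ⟨h3, h4⟩ := h
  rw [embConj_apply, lam] at h3 h4
  rw [emb_apply] at h1 h2
  have hy1 : (-2 : ℝ) < x.im := by nlinarith
  have hy2 : (x.im : ℝ) < 2 := by nlinarith
  have hx1 : (-2 : ℝ) < x.re := by nlinarith
  have hx2 : (x.re : ℝ) < 3 := by nlinarith
  have hy1' : -2 < x.im := by exact_mod_cast hy1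
  have hy2' : x.im < 2 := by exact_mod_cast hy2
  have hx1' : -2 < x.re := by exact_mod_cast hx1
  have hx2' : x.re < 3 := by exact_mod_cast hx2
  have hy : x.im = -1 ∨ x.im = 0 ∨ x.im = 1 := by omega
  have hx : x.re = -1 ∨ x.re = 0 ∨ x.re = 1 ∨ x.re = 2 := by omega
  rcases hx with hx | hx | hx | hx <;> rcases hy with hy | hy | hy <;>
    rw [hx, hy] at h1 h2 h3 h4 <;> push_cast at h1 h2 h3 h4 <;> linarith

/-- The fundamental unit `1 + √2` of `ℤ[√2]`. -/
def lamUnit : (ℤ√2)ˣ where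
  val := ⟨1, 1⟩
  inv := ⟨-1, 1⟩
  val_inv := by decide
  inv_val := by decide

theorem emb_lamUnit : emb lamUnit = lam := by
  simp [emb_apply, lamUnit, lam]

theorem embConj_lamUnit : embConj lamUnit = -lam⁻¹ := by
  have hs : √2 * √2 = 2 := Real.mul_self_sqrt (by norm_num)
  have h : lam ≠ 0 := (one_pos.trans one_lt_lam).ne'
  have h2 : lam * (√2 - 1) = 1 := by rw [lam]; linear_combination hs
  rw [← eq_inv_of_mul_eq_one_right h2]
  simp [embConj_apply, lamUnit]

theorem abs_norm_unit (u : (ℤ√2)ˣ) : |emb u| * |embConj u| = 1 := by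
  have h := Zsqrtd.norm_eq_one_iff.mpr u.isUnit
  rw [← abs_mul, emb_mul_embConj, ← Int.cast_abs, Int.abs_eq_natAbs, h]
  norm_num

/-- A unit strictly between 1 and `lam` would have a conjugate of absolute value below 1, which the
gap forbids. Hence `lam` is fundamental. -/
theorem unit_eq_one_of_emb_mem_Ico {u : (ℤ√2)ˣ} (h1 : 1 ≤ emb u) (h2 : emb u < lam) : u = 1 := by
  rcases h1.eq_or_lt with h | h
  · ext1
    exact emb_injective (by simpa using h.symm)
  · exfalso
    have hn := abs_norm_unit u
    have h3 : 1 ≤ |embConj u| := by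
      rcases embConj_of_emb_mem_Ioo_one_lam h h2 with h | h
      · exact h.trans (le_abs_self _)
      · rw [le_abs]
        right
        linarith [sqrt_two_bounds.1]
    have h4 : 1 < |emb u| := lt_of_lt_of_le h (le_abs_self _)
    nlinarith

theorem eq_of_associated_of_mem_Ico {x y : ℤ√2} (h : Associated x y)
    (hx : emb x ∈ Set.Ico 1 lam) (hy : emb y ∈ Set.Ico 1 lam) : x = y := by
  wlog hxy : emb x ≤ emb y generalizing x y
  · exact (this h.symm hy hx (le_of_not_ge hxy)).symm
  obtain ⟨u, rfl⟩ := h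
  have hx0 : 0 < emb x := one_pos.trans_le hx.1
  rw [map_mul] at hxy hy
  have h1 : 1 ≤ emb u := by nlinarith
  have h2 : emb u < lam := by nlinarith [hx.1, hy.2]
  rw [unit_eq_one_of_emb_mem_Ico h1 h2]
  simp

theorem emb_lamUnit_zpow (n : ℤ) : emb ↑(lamUnit ^ n) = lam ^ n := by
  have : Units.map (emb : ℤ√2 →* ℝ) (lamUnit ^ n) = (Units.map (emb : ℤ√2 →* ℝ) lamUnit) ^ n :=
    map_zpow _ _ _
  have h := congrArg Units.val this
  rw [Units.val_zpow_eq_zpow_val] at h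
  exact h.trans (congrArg (· ^ n) emb_lamUnit)

/-- Adjust the sign, then multiply by a power of `lamUnit`. With `eq_of_associated_of_mem_Ico` this
makes `[1, lam)` a set of representatives for association, so `ℙ` has one generator for each prime
ideal. -/
theorem exists_associated_mem_Ico {x : ℤ√2} (hx : x ≠ 0) :
    ∃ y, Associated x y ∧ emb y ∈ Set.Ico 1 lam := by
  wlog hpos : 0 < emb x generalizing x
  · have h0 : emb x ≠ 0 := fun h => hx (emb_eq_zero.mp h)
    obtain ⟨y, hy, hy'⟩ := this (neg_ne_zero.mpr hx)
      (by rw [map_neg]; exact neg_pos.mpr (lt_of_le_of_ne (not_lt.mp hpos) h0))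
    exact ⟨y, Associated.neg_left_iff.mp hy, hy'⟩
  obtain ⟨n, hn1, hn2⟩ := exists_mem_Ico_zpow hpos one_lt_lam
  have hl : 0 < lam := one_pos.trans one_lt_lam
  refine ⟨x * ↑(lamUnit ^ (-n)), ⟨_, rfl⟩, ?_⟩
  rw [map_mul, emb_lamUnit_zpow, zpow_neg, ← div_eq_mul_inv]
  have : 0 < lam ^ n := zpow_pos hl n
  constructor
  · rwa [le_div_iff₀ this, one_mul]
  · rwa [div_lt_iff₀ this, ← zpow_one_add₀ hl.ne', add_comm]

/-! ### The ring of integers of `ℚ(√2)` is `ℤ[√2]`. -/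

open NumberField

/-- `√2` as an element of `ℚ(√2)`. -/
noncomputable def sqrtTwoGen : QSqrtTwo := IntermediateField.AdjoinSimple.gen ℚ √2

theorem coe_sqrtTwoGen : (sqrtTwoGen : ℝ) = √2 := IntermediateField.AdjoinSimple.coe_gen ℚ √2

theorem sqrtTwoGen_mul_self : sqrtTwoGen * sqrtTwoGen = 2 := by
  apply Subtype.ext
  push_cast
  rw [coe_sqrtTwoGen]
  exact Real.mul_self_sqrt (by norm_num)

theorem isIntegral_sqrtTwoGen : IsIntegral ℤ sqrtTwoGen :=
  ⟨Polynomial.X ^ 2 - Polynomial.C 2, Polynomial.monic_X_pow_sub_C _ (by norm_num), by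
    simp [pow_two, sqrtTwoGen_mul_self]⟩

/-- `√2` as an element of the ring of integers of `ℚ(√2)`. -/
noncomputable def sqrtTwoInt : 𝓞 QSqrtTwo := ⟨sqrtTwoGen, isIntegral_sqrtTwoGen⟩

theorem algebraMap_sqrtTwoInt : algebraMap (𝓞 QSqrtTwo) QSqrtTwo sqrtTwoInt = sqrtTwoGen := rfl

theorem sqrtTwoInt_mul_self : sqrtTwoInt * sqrtTwoInt = ((2 : ℤ) : 𝓞 QSqrtTwo) := by
  apply RingOfIntegers.coe_injective (K := QSqrtTwo)
  rw [map_mul, map_intCast, algebraMap_sqrtTwoInt, sqrtTwoGen_mul_self]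
  rfl

/-- The inclusion of `ℤ[√2]` into the ring of integers of `ℚ(√2)`. -/
noncomputable def zsqrtdToIntegers : ℤ√2 →+* 𝓞 QSqrtTwo :=
  Zsqrtd.lift ⟨sqrtTwoInt, sqrtTwoInt_mul_self⟩

theorem coe_zsqrtdToIntegers (x : ℤ√2) : ((zsqrtdToIntegers x : QSqrtTwo) : ℝ) = emb x := by
  have : (((algebraMap QSqrtTwo ℝ).comp (algebraMap (𝓞 QSqrtTwo) QSqrtTwo)).comp
      zsqrtdToIntegers) = emb := by
    apply Zsqrtd.hom_ext
    simp [zsqrtdToIntegers, Zsqrtd.lift, emb, algebraMap_sqrtTwoInt, coe_sqrtTwoGen]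
  exact congrArg (fun f => f x) this

theorem zsqrtdToIntegers_injective : Function.Injective zsqrtdToIntegers := fun x y h => by
  apply emb_injective
  rw [← coe_zsqrtdToIntegers, ← coe_zsqrtdToIntegers, h]

theorem exists_mul_emb_eq_emb (z : ℝ) (hz : z ∈ QSqrtTwo) :
    ∃ a n : ℤ√2, n ≠ 0 ∧ z * emb n = emb a := by
  induction hz using IntermediateField.adjoin_induction with
  | mem x hx =>
    rw [Set.mem_singleton_iff] at hx
    exact ⟨⟨0, 1⟩, 1, one_ne_zero, by simp [emb_apply, hx]⟩
  | algebraMap x =>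
    refine ⟨x.num, x.den, by simp, ?_⟩
    have := Rat.mul_den_eq_num x
    simp only [eq_ratCast, map_natCast, map_intCast]
    exact_mod_cast this
  | add x y _ _ hx hy =>
    obtain ⟨a, n, hn, h⟩ := hx
    obtain ⟨b, m, hm, h'⟩ := hy
    refine ⟨a * m + b * n, n * m, mul_ne_zero hn hm, ?_⟩
    simp only [map_mul, map_add, ← h, ← h']
    ring
  | inv x _ hx =>
    obtain ⟨a, n, hn, h⟩ := hx
    by_cases hx : x = 0
    · exact ⟨0, 1, one_ne_zero, by simp [hx]⟩
    · refine ⟨n, a, ?_, ?_⟩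
      · rw [Ne, ← emb_eq_zero, ← h]
        simp [hx, emb_eq_zero, hn]
      · rw [← h]
        field_simp
  | mul x y _ _ hx hy =>
    obtain ⟨a, n, hn, h⟩ := hx
    obtain ⟨b, m, hm, h'⟩ := hy
    refine ⟨a * b, n * m, mul_ne_zero hn hm, ?_⟩
    simp only [map_mul, ← h, ← h']
    ring

/-- `ℤ[√2]` is principal, hence integrally closed, and `ℚ(√2)` is its fraction field by
`exists_mul_emb_eq_emb`. -/
theorem zsqrtdToIntegers_surjective : Function.Surjective zsqrtdToIntegers := by
  intro z
  let _ : Algebra (ℤ√2) QSqrtTwo :=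
    ((algebraMap (𝓞 QSqrtTwo) QSqrtTwo).comp zsqrtdToIntegers).toAlgebra
  have hmap (x : ℤ√2) : algebraMap (ℤ√2) QSqrtTwo x = (zsqrtdToIntegers x : QSqrtTwo) := rfl
  have hinj : Function.Injective (algebraMap (ℤ√2) QSqrtTwo) :=
    RingOfIntegers.coe_injective.comp zsqrtdToIntegers_injective
  have : IsFractionRing (ℤ√2) QSqrtTwo := by
    have : FaithfulSMul (ℤ√2) QSqrtTwo := (faithfulSMul_iff_algebraMap_injective _ _).mpr hinj
    refine .of_field _ _ fun w => ?_
    obtain ⟨a, n, hn, h⟩ := exists_mul_emb_eq_emb w w.2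
    refine ⟨a, n, ?_⟩
    apply Subtype.ext
    simp only [hmap, IntermediateField.coe_div, coe_zsqrtdToIntegers]
    rw [← h, mul_div_cancel_right₀ _ (emb_eq_zero.not.mpr hn)]
  have hz : IsIntegral (ℤ√2) (z : QSqrtTwo) := (RingOfIntegers.isIntegral_coe z).tower_top
  obtain ⟨y, hy⟩ := IsIntegrallyClosed.isIntegral_iff.mp hz
  exact ⟨y, RingOfIntegers.coe_injective hy⟩

/-- The ring of integers of `ℚ(√2)` is `ℤ[√2]`. -/
noncomputable def integersEquiv : ℤ√2 ≃+* 𝓞 QSqrtTwo :=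
  RingEquiv.ofBijective zsqrtdToIntegers ⟨zsqrtdToIntegers_injective, zsqrtdToIntegers_surjective⟩

theorem coe_integersEquiv (x : ℤ√2) : ((integersEquiv x : QSqrtTwo) : ℝ) = emb x :=
  coe_zsqrtdToIntegers x

theorem mem_primesP {c : ℝ} :
    c ∈ primesP ↔ ∃ p : ℤ√2, Prime p ∧ emb p = c ∧ 1 < c ∧ c < lam := by
  constructor
  · rintro ⟨p, hp, h⟩
    obtain ⟨q, rfl⟩ := integersEquiv.surjective p
    exact ⟨q, (MulEquiv.prime_iff integersEquiv).mp hp, by rwa [coe_integersEquiv] at h⟩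
  · rintro ⟨p, hp, h⟩
    exact ⟨integersEquiv p, (MulEquiv.prime_iff integersEquiv).mpr hp, by rwa [coe_integersEquiv]⟩

/-- The additive coordinates on `ℤ[√2]`. -/
def zsqrtdLinearEquiv : ℤ√2 ≃ₗ[ℤ] (Fin 2 → ℤ) where
  toFun x := ![x.re, x.im]
  invFun v := ⟨v 0, v 1⟩
  map_add' x y := by ext i; fin_cases i <;> simp
  map_smul' n x := by
    ext i
    fin_cases i <;> simp
  left_inv x := rfl
  right_inv v := by ext i; fin_cases i <;> simp

theorem zsqrtdLinearEquiv_apply (x : ℤ√2) : zsqrtdLinearEquiv x = ![x.re, x.im] := rfl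

theorem zsqrtdLinearEquiv_symm_apply (v : Fin 2 → ℤ) :
    zsqrtdLinearEquiv.symm v = ⟨v 0, v 1⟩ := rfl

theorem algebraNorm_zsqrtd (x : ℤ√2) : Algebra.norm ℤ x = x.norm := by
  rw [Algebra.norm_eq_matrix_det (Module.Basis.ofEquivFun zsqrtdLinearEquiv), Matrix.det_fin_two,
    Zsqrtd.norm_def]
  simp [Algebra.leftMulMatrix_eq_repr_mul, zsqrtdLinearEquiv_apply, zsqrtdLinearEquiv_symm_apply]

theorem absNorm_span_integersEquiv (x : ℤ√2) :
    Ideal.absNorm (Ideal.span {integersEquiv x}) = x.norm.natAbs := by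
  rw [Ideal.absNorm_span_singleton, ← algebraNorm_zsqrtd,
    Algebra.norm_eq_of_equiv_equiv (RingEquiv.refl ℤ) integersEquiv (RingHom.ext_int _ _)]
  rfl

/-! ### Coordinates on `ℤ[ζ]` over `ℤ[√2]`. -/

/-- The point `α + β ζ` of `ℤ[ζ]`. -/
noncomputable def cycl (q : ℤ√2 × ℤ√2) : ℂ := emb q.1 + emb q.2 * zeta8

/-- The image `α' + β' ζ ^ 3` of the point `α + β ζ` of `ℤ[ζ]` under `σ`. -/
noncomputable def cyclStar (q : ℤ√2 × ℤ√2) : ℂ := embConj q.1 + embConj q.2 * zeta8 ^ 3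

theorem sqrt_two_sq_complex : (√2 : ℂ) ^ 2 = 2 := by
  norm_cast
  simp

theorem zeta8_eq' : zeta8 = (√2 : ℂ) / 2 * (1 + Complex.I) := by
  rw [zeta8_eq]
  push_cast
  ring

theorem zeta8_sq : zeta8 ^ 2 = √2 * zeta8 - 1 := by
  rw [zeta8_eq']
  linear_combination ((√2 : ℂ) ^ 2 / 4) * Complex.I_sq -
    (1 / 2 : ℂ) * sqrt_two_sq_complex

theorem zeta8_sq_eq_I : zeta8 ^ 2 = Complex.I := by
  rw [zeta8_sq, zeta8_eq']
  linear_combination (1 / 2 + Complex.I / 2) * sqrt_two_sq_complex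

theorem zeta8_pow_three : zeta8 ^ 3 = (√2 : ℂ) / 2 * (Complex.I - 1) := by
  rw [pow_succ, zeta8_sq_eq_I, zeta8_eq']
  linear_combination (√2 : ℂ) / 2 * Complex.I_sq

theorem cycl_re (q : ℤ√2 × ℤ√2) : (cycl q).re = emb q.1 + emb q.2 * (√2 / 2) := by
  simp [cycl, zeta8_eq]

theorem cycl_im (q : ℤ√2 × ℤ√2) : (cycl q).im = emb q.2 * (√2 / 2) := by
  simp [cycl, zeta8_eq]

theorem cyclStar_eq (q : ℤ√2 × ℤ√2) :
    cyclStar q = ((embConj q.1 - embConj q.2 * (√2 / 2) : ℝ) : ℂ) +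
      (embConj q.2 * (√2 / 2) : ℝ) * Complex.I := by
  rw [cyclStar, zeta8_pow_three]
  push_cast
  ring

theorem cyclStar_re (q : ℤ√2 × ℤ√2) :
    (cyclStar q).re = embConj q.1 - embConj q.2 * (√2 / 2) := by
  simp [cyclStar_eq]

theorem cyclStar_im (q : ℤ√2 × ℤ√2) : (cyclStar q).im = embConj q.2 * (√2 / 2) := by
  simp [cyclStar_eq]

theorem cycl_injective : Function.Injective cycl := by
  intro p q h
  have h1 := congrArg Complex.re h
  have h2 := congrArg Complex.im h
  rw [cycl_im, cycl_im, mul_left_inj' (by positivity)] at h2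
  rw [cycl_re, cycl_re, h2, add_left_inj] at h1
  exact Prod.ext (emb_injective h1) (emb_injective h2)

theorem cycl_zero : cycl 0 = 0 := by simp [cycl]

theorem cycl_add (p q : ℤ√2 × ℤ√2) : cycl (p + q) = cycl p + cycl q := by
  simp only [cycl, Prod.fst_add, Prod.snd_add, map_add]
  push_cast
  ring

theorem cyclStar_add (p q : ℤ√2 × ℤ√2) : cyclStar (p + q) = cyclStar p + cyclStar q := by
  simp only [cyclStar, Prod.fst_add, Prod.snd_add, map_add]
  push_cast
  ring

theorem cycl_smul (c : ℤ√2) (q : ℤ√2 × ℤ√2) : cycl (c • q) = emb c • cycl q := by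
  simp only [cycl, Prod.smul_fst, Prod.smul_snd, smul_eq_mul, map_mul, Complex.real_smul]
  push_cast
  ring

theorem cyclStar_smul (c : ℤ√2) (q : ℤ√2 × ℤ√2) :
    cyclStar (c • q) = embConj c • cyclStar q := by
  simp only [cyclStar, Prod.smul_fst, Prod.smul_snd, smul_eq_mul, map_mul, Complex.real_smul]
  push_cast
  ring

theorem coe_zetaGen : ((zetaGen : QZeta) : ℂ) = zeta8 := by simp [zetaGen]

theorem zeta8_pow_three_sq : (zeta8 ^ 3) ^ 2 = -√2 * zeta8 ^ 3 - 1 := by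
  rw [zeta8_pow_three]
  linear_combination ((√2 : ℂ) ^ 2 / 4) * Complex.I_sq - (1 / 2 : ℂ) * sqrt_two_sq_complex

theorem exists_cycl_of_mem_ZZeta {x : QZeta} (hx : x ∈ ZZeta) :
    ∃ q, cycl q = x ∧ cyclStar q = (sigma x : QZeta) := by
  induction hx using Algebra.adjoin_induction with
  | mem x hx =>
    rw [Set.mem_singleton_iff] at hx
    subst hx
    refine ⟨(0, 1), ?_, ?_⟩
    · simp [cycl, coe_zetaGen]
    · simp [cyclStar, sigma_zetaGen, coe_zetaGen]
  | algebraMap n =>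
    exact ⟨(n, 0), by simp [cycl], by simp [cyclStar]⟩
  | add x y _ _ hx hy =>
    obtain ⟨p, hp, hp'⟩ := hx
    obtain ⟨q, hq, hq'⟩ := hy
    exact ⟨p + q, by simp [cycl_add, hp, hq], by simp [cyclStar_add, hp', hq']⟩
  | mul x y _ _ hx hy =>
    obtain ⟨⟨a, b⟩, hp, hp'⟩ := hx
    obtain ⟨⟨c, d⟩, hq, hq'⟩ := hy
    -- The product is reduced with `ζ² = √2 ζ - 1`; on the `σ` side `ζ³` satisfies the conjugate
    -- relation, with `-√2`.
    refine ⟨(a * c - b * d, a * d + b * c + ⟨0, 1⟩ * b * d), ?_, ?_⟩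
    · have h : (emb ⟨0, 1⟩ : ℝ) = √2 := by simp [emb_apply]
      rw [MulMemClass.coe_mul, ← hp, ← hq]
      simp only [cycl, map_sub, map_add, map_mul, h]
      push_cast
      linear_combination -(emb b * emb d : ℂ) * zeta8_sq
    · have h : (embConj ⟨0, 1⟩ : ℝ) = -√2 := by simp [embConj_apply]
      rw [map_mul, MulMemClass.coe_mul, ← hp', ← hq']
      simp only [cyclStar, map_sub, map_add, map_mul, h]
      push_cast
      linear_combination -(embConj b * embConj d : ℂ) * zeta8_pow_three_sq

theorem exists_mem_ZZeta_eq_cycl (q : ℤ√2 × ℤ√2) :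
    ∃ x ∈ ZZeta, cycl q = (x : QZeta) ∧ cyclStar q = (sigma x : QZeta) := by
  have hz : zetaGen ∈ ZZeta := Algebra.subset_adjoin rfl
  -- `√2 = ζ - ζ³`, and `σ` negates it because `ζ⁹ = ζ`.
  have hs : zetaGen - zetaGen ^ 3 ∈ ZZeta := sub_mem hz (pow_mem hz 3)
  have h1 : ((zetaGen - zetaGen ^ 3 : QZeta) : ℂ) = √2 := by
    push_cast
    rw [coe_zetaGen, zeta8_pow_three, zeta8_eq']
    ring
  have h2 : ((sigma (zetaGen - zetaGen ^ 3) : QZeta) : ℂ) = -√2 := by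
    have h9 : (zeta8 ^ 3) ^ 3 = zeta8 := by
      rw [← pow_mul]
      have := zeta8_isPrimitiveRoot.pow_eq_one
      linear_combination zeta8 * this
    rw [map_sub, map_pow, sigma_zetaGen]
    push_cast
    rw [coe_zetaGen, h9, zeta8_pow_three, zeta8_eq']
    ring
  set s := zetaGen - zetaGen ^ 3
  refine ⟨(q.1.re + q.1.im * s) + (q.2.re + q.2.im * s) * zetaGen,
    add_mem (add_mem (intCast_mem _ _) (mul_mem (intCast_mem _ _) hs))
      (mul_mem (add_mem (intCast_mem _ _) (mul_mem (intCast_mem _ _) hs)) hz), ?_, ?_⟩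
  · push_cast
    rw [h1, coe_zetaGen, cycl, emb_apply, emb_apply]
    push_cast
    rfl
  · simp only [map_add, map_mul, map_intCast, sigma_zetaGen]
    push_cast
    rw [h2, coe_zetaGen, cyclStar, embConj_apply, embConj_apply]
    push_cast
    ring

theorem ASet_eq (W : Set ℂ) : ASet W = cycl '' {q | cyclStar q ∈ W} := by
  ext z
  constructor
  · rintro ⟨x, ⟨hx, hW⟩, rfl⟩
    obtain ⟨q, hq, hq'⟩ := exists_cycl_of_mem_ZZeta hx
    exact ⟨q, by rwa [Set.mem_ofPred_eq, hq'], hq⟩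
  · rintro ⟨q, hq, rfl⟩
    obtain ⟨x, hx, hx', hxs⟩ := exists_mem_ZZeta_eq_cycl q
    exact ⟨x, ⟨hx, by rwa [← hxs]⟩, hx'.symm⟩

theorem cycl_mem_ASet {W : Set ℂ} {q : ℤ√2 × ℤ√2} : cycl q ∈ ASet W ↔ cyclStar q ∈ W := by
  rw [ASet_eq, cycl_injective.mem_set_image]
  rfl

/-! ### Occlusion quotients. -/

/-- For `c ≤ -√2` write `-w = √2 v` with `v ∈ W`; then `w / c = (√2 / |c|) v` is a shrinking of `v`.
-/
theorem IsWindow.inv_smul_mem {W : Set ℂ} (hW : IsWindow W) {w : ℂ} (hw : w ∈ W) {c : ℝ}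
    (hc : 1 ≤ c ∨ c ≤ -√2) : c⁻¹ • w ∈ W := by
  rcases hc with hc | hc
  · exact hW.2.1.smul_mem hw (by positivity) (inv_le_one_of_one_le₀ hc)
  · have hs : 0 < √2 := by positivity
    obtain ⟨v, hv, hvw⟩ := hW.2.2 (Set.neg_mem_neg.mpr hw)
    have : c⁻¹ • w = (√2 * (-c)⁻¹) • v := by
      rw [← neg_neg w, ← hvw, inv_neg]
      simp only [smul_neg, smul_smul]
      rw [← neg_smul]
      congr 1
      ring
    rw [this]
    have hc' : 0 < -c := by linarith
    refine hW.2.1.smul_mem hv (by positivity) ?_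
    rw [← div_eq_mul_inv, div_le_one hc']
    linarith

theorem lam_mem_quotC : lam ∈ quotC := Or.inr rfl

theorem exists_prime_dvd_emb_mem_primesP {b : ℤ√2} (hb0 : b ≠ 0) (hb : ¬IsUnit b) :
    ∃ p : ℤ√2, Prime p ∧ p ∣ b ∧ 1 < emb p ∧ emb p < lam := by
  obtain ⟨i, hi, hib⟩ := WfDvdMonoid.exists_irreducible_factor hb hb0
  obtain ⟨p, hip, hp1, hp2⟩ := exists_associated_mem_Ico hi.ne_zero
  have hp : Prime p := (hip.irreducible hi).prime
  refine ⟨p, hp, hip.dvd_iff_dvd_left.mp hib, lt_of_le_of_ne hp1 fun h => ?_, hp2⟩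
  rw [← map_one emb] at h
  exact hp.ne_one (emb_injective h).symm

theorem inv_emb_smul_mem_ASet {W : Set ℂ} {b : ℤ√2} (hb : b ≠ 0) {q : ℤ√2 × ℤ√2}
    (h : (embConj b)⁻¹ • cyclStar (b • q) ∈ W) : (emb b)⁻¹ • cycl (b • q) ∈ ASet W := by
  rw [cyclStar_smul, smul_smul, inv_mul_cancel₀ (embConj_eq_zero.not.mpr hb), one_smul] at h
  rwa [cycl_smul, smul_smul, inv_mul_cancel₀ (emb_eq_zero.not.mpr hb), one_smul, cycl_mem_ASet]

theorem one_lt_of_mem_quotC {c : ℝ} (hc : c ∈ quotC) : 1 < c := by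
  rcases hc with hc | rfl
  · obtain ⟨_, _, _, h, _⟩ := hc
    exact h
  · exact one_lt_lam

/-- If the real multiple `t x` of `x ∈ ℤ[ζ]` lies in `ℤ[ζ]`, then the reduced denominator of `t`
divides `x`. -/
theorem exists_denominator {t : ℝ} {p q : ℤ√2 × ℤ√2} (hq : q ≠ 0) (h : t • cycl q = cycl p) :
    ∃ a b : ℤ√2, ∃ q', b ≠ 0 ∧ q = b • q' ∧ t * emb b = emb a := by
  have h1 := congrArg Complex.re h
  have h2 := congrArg Complex.im h
  rw [Complex.smul_im, cycl_im, cycl_im, smul_eq_mul, ← mul_assoc,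
    mul_left_inj' (by positivity)] at h2
  rw [Complex.smul_re, cycl_re, cycl_re, smul_eq_mul, mul_add, ← mul_assoc, h2,
    add_left_inj] at h1
  -- The ideal of denominators of `t`. Both coordinates of `q` lie in it, so its generator divides
  -- both.
  let I : Ideal (ℤ√2) :=
    { carrier := {b | ∃ a, t * emb b = emb a}
      add_mem' := by
        rintro x y ⟨a, ha⟩ ⟨b, hb⟩
        exact ⟨a + b, by rw [map_add, map_add, mul_add, ha, hb]⟩
      zero_mem' := ⟨0, by simp⟩
      smul_mem' := by
        rintro c x ⟨a, ha⟩
        exact ⟨c * a, by rw [smul_eq_mul, map_mul, map_mul, ← ha]; ring⟩ }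
  have hq1 : q.1 ∈ I := ⟨_, h1⟩
  have hq2 : q.2 ∈ I := ⟨_, h2⟩
  obtain ⟨a, ha⟩ : Submodule.IsPrincipal.generator I ∈ I := Submodule.IsPrincipal.generator_mem I
  obtain ⟨c, hc⟩ := (Submodule.IsPrincipal.mem_iff_generator_dvd I).mp hq1
  obtain ⟨d, hd⟩ := (Submodule.IsPrincipal.mem_iff_generator_dvd I).mp hq2
  refine ⟨a, Submodule.IsPrincipal.generator I, (c, d), fun h0 => hq ?_, Prod.ext hc hd, ha⟩
  rw [h0, zero_mul] at hc hd
  exact Prod.ext hc hd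

theorem IsWindow.isOcclusionQuotients {W : Set ℂ} (hW : IsWindow W) :
    IsOcclusionQuotients quotC (ASet W) := by
  refine ⟨fun c => one_lt_of_mem_quotC, ?_⟩
  have hl : 0 < lam := one_pos.trans one_lt_lam
  rintro x ⟨hx, hxv⟩
  obtain ⟨t, ht0, ht1, ht⟩ : ∃ t : ℝ, 0 < t ∧ t < 1 ∧ t • x ∈ ASet W := by
    by_contra! h
    exact hxv ⟨hx, h⟩
  by_cases hx0 : x = 0
  · subst hx0
    exact ⟨lam, lam_mem_quotC, by simpa using hx⟩
  rw [ASet_eq] at hx ht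
  obtain ⟨q, hqW, rfl⟩ := hx
  obtain ⟨p, hpW, hp⟩ := ht
  have hq0 : q ≠ 0 := by
    rintro rfl
    exact hx0 cycl_zero
  obtain ⟨a, b, q', hb, rfl, hab⟩ := exists_denominator hq0 hp.symm
  by_cases hu : IsUnit b
  · obtain ⟨u, rfl⟩ := hu
    refine ⟨lam, lam_mem_quotC, ?_⟩
    set s : ℤ√2 := a * ↑u⁻¹ with hs
    have hemb : emb s = t := by
      rw [hs, map_mul, ← hab, mul_assoc, ← map_mul]
      simp
    have hpq : p = s • ((u : ℤ√2) • q') := by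
      apply cycl_injective
      rw [cycl_smul, hemb, hp]
    have hs' := embConj_of_emb_mem_Ioo_zero_one (hemb.symm ▸ ht0) (hemb.symm ▸ ht1)
    have hsne : embConj s ≠ 0 := by
      rw [Ne, embConj_eq_zero, ← emb_eq_zero, hemb]
      exact ht0.ne'
    -- With `p = s x` one has `σ(x / λ) = -λ σ(x) = (-s' / λ)⁻¹ σ(p)`, and the gap for `s ∈ (0, 1)`
    -- puts `-s' / λ` in the admissible range.
    have hkey : (-embConj s / lam)⁻¹ • cyclStar p ∈ W := by
      refine hW.inv_smul_mem hpW ?_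
      rw [le_div_iff₀ hl, div_le_iff₀ hl]
      rcases hs' with h | h
      · right; linarith
      · left; linarith
    rw [← emb_lamUnit]
    have hmul : ((u : ℤ√2) • q') =
        (lamUnit : ℤ√2) • ((↑lamUnit⁻¹ : ℤ√2) • ((u : ℤ√2) • q')) := by
      rw [smul_smul, Units.mul_inv, one_smul]
    rw [hmul]
    apply inv_emb_smul_mem_ASet lamUnit.ne_zero
    rw [← hmul]
    convert hkey using 1
    rw [hpq, cyclStar_smul s, smul_smul, embConj_lamUnit]
    congr 1
    field_simp
  · obtain ⟨π, hπ, ⟨d, rfl⟩, h1, h2⟩ := exists_prime_dvd_emb_mem_primesP hb hu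
    refine ⟨emb π, Or.inl (mem_primesP.mpr ⟨π, hπ, rfl, h1, h2⟩), ?_⟩
    rw [mul_smul] at hqW ⊢
    exact inv_emb_smul_mem_ASet hπ.ne_zero
      (hW.inv_smul_mem hqW (embConj_of_emb_mem_Ioo_one_lam h1 h2))

/-! ### The lattice of all `(x, σ x)` and its covolume. -/

/-- The standard real basis of `ℂ × ℂ`. -/
noncomputable def stdBasis : Module.Basis (Fin 2 ⊕ Fin 2) ℝ (ℂ × ℂ) :=
  Complex.basisOneI.prod Complex.basisOneI

/-- A `ℤ`-basis of the lattice of all `(x, σ x)`, `x ∈ ℤ[ζ]`. -/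
noncomputable def latticeVec : Fin 2 ⊕ Fin 2 → ℂ × ℂ :=
  Sum.elim ![(cycl (1, 0), cyclStar (1, 0)), (cycl (⟨0, 1⟩, 0), cyclStar (⟨0, 1⟩, 0))]
    ![(cycl (0, 1), cyclStar (0, 1)), (cycl (0, ⟨0, 1⟩), cyclStar (0, ⟨0, 1⟩))]

theorem stdBasis_toMatrix_latticeVec :
    (stdBasis.toMatrix latticeVec).submatrix finSumFinEquiv.symm finSumFinEquiv.symm =
      !![1, √2, √2 / 2, 1; 0, 0, √2 / 2, 1; 1, -√2, -(√2 / 2), 1; 0, 0, √2 / 2, -1] := by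
  have hs : √2 * (√2 / 2) = 1 := by
    have := Real.mul_self_sqrt (show (0 : ℝ) ≤ 2 by norm_num)
    linarith
  have e0 : (finSumFinEquiv.symm 0 : Fin 2 ⊕ Fin 2) = Sum.inl 0 := rfl
  have e1 : (finSumFinEquiv.symm 1 : Fin 2 ⊕ Fin 2) = Sum.inl 1 := rfl
  have e2 : (finSumFinEquiv.symm 2 : Fin 2 ⊕ Fin 2) = Sum.inr 0 := rfl
  have e3 : (finSumFinEquiv.symm 3 : Fin 2 ⊕ Fin 2) = Sum.inr 1 := rfl
  ext i j
  fin_cases i <;> fin_cases j <;>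
    simp [e0, e1, e2, e3, stdBasis, latticeVec, Module.Basis.toMatrix_apply, cycl_re, cycl_im,
      cyclStar_re, cyclStar_im, emb_apply, embConj_apply, hs]

theorem abs_det_latticeVec : |stdBasis.det latticeVec| = 4 := by
  have hs : √2 * √2 = 2 := Real.mul_self_sqrt (by norm_num)
  rw [Module.Basis.det_apply, ← Matrix.det_submatrix_equiv_self finSumFinEquiv.symm,
    stdBasis_toMatrix_latticeVec]
  simp [Matrix.det_succ_row_zero, Fin.sum_univ_succ, Fin.succAbove]
  ring_nf
  simp
  norm_num

theorem linearIndependent_latticeVec_and_span_eq_top :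
    LinearIndependent ℝ latticeVec ∧ Submodule.span ℝ (Set.range latticeVec) = ⊤ :=
  (Module.Basis.is_basis_iff_det stdBasis).mpr (isUnit_iff_ne_zero.mpr fun h => by
    have := abs_det_latticeVec
    rw [h] at this
    norm_num at this)

/-- The lattice basis as a real basis of `ℂ × ℂ`. -/
noncomputable def latticeBasis : Module.Basis (Fin 2 ⊕ Fin 2) ℝ (ℂ × ℂ) :=
  Module.Basis.mk linearIndependent_latticeVec_and_span_eq_top.1
    linearIndependent_latticeVec_and_span_eq_top.2.ge

theorem coe_latticeBasis : ⇑latticeBasis = latticeVec := Module.Basis.coe_mk _ _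

theorem mem_span_latticeBasis {v : ℂ × ℂ} :
    v ∈ Submodule.span ℤ (Set.range latticeBasis) ↔ ∃ q, (cycl q, cyclStar q) = v := by
  rw [Submodule.mem_span_range_iff_exists_fun, coe_latticeBasis]
  have key (c : Fin 2 ⊕ Fin 2 → ℤ) : ∑ i, c i • latticeVec i =
      (cycl (⟨c (.inl 0), c (.inl 1)⟩, ⟨c (.inr 0), c (.inr 1)⟩),
        cyclStar (⟨c (.inl 0), c (.inl 1)⟩, ⟨c (.inr 0), c (.inr 1)⟩)) := by
    simp [latticeVec, Fin.sum_univ_two, cycl, cyclStar, emb_apply, embConj_apply]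
    refine Prod.ext ?_ ?_ <;> simp <;> ring
  constructor
  · rintro ⟨c, rfl⟩
    exact ⟨_, (key c).symm⟩
  · rintro ⟨q, rfl⟩
    exact ⟨Sum.elim ![q.1.re, q.1.im] ![q.2.re, q.2.im], key _⟩

theorem volume_fundamentalDomain_stdBasis :
    volume (ZSpan.fundamentalDomain stdBasis) = 1 := by
  have h : ZSpan.fundamentalDomain stdBasis =
      (Complex.measurableEquivRealProd ⁻¹' (Set.Ico 0 1 ×ˢ Set.Ico 0 1)) ×ˢ
      (Complex.measurableEquivRealProd ⁻¹' (Set.Ico 0 1 ×ˢ Set.Ico 0 1)) := by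
    ext ⟨x, y⟩
    simp [ZSpan.mem_fundamentalDomain, stdBasis, Fin.forall_fin_two]
  have h1 : volume (Complex.measurableEquivRealProd ⁻¹'
      ((Set.Ico 0 1 : Set ℝ) ×ˢ (Set.Ico 0 1 : Set ℝ))) = 1 := by
    rw [Complex.volume_preserving_equiv_real_prod.measure_preimage
      (measurableSet_Ico.prod measurableSet_Ico).nullMeasurableSet,
      Measure.volume_eq_prod, Measure.prod_prod]
    simp
  rw [h, Measure.volume_eq_prod, Measure.prod_prod, h1, one_mul]

instance : (volume : Measure (ℂ × ℂ)).IsAddHaarMeasure := Measure.prod.instIsAddHaarMeasure _ _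

theorem volume_fundamentalDomain_latticeBasis :
    volume (ZSpan.fundamentalDomain latticeBasis) = 4 := by
  rw [ZSpan.measure_fundamentalDomain latticeBasis volume stdBasis, coe_latticeBasis,
    abs_det_latticeVec, volume_fundamentalDomain_stdBasis]
  simp

/-! ### Lattice points and volume. -/

section Counting

variable {E ι : Type*} [NormedAddCommGroup E] [NormedSpace ℝ E] [MeasurableSpace E] [BorelSpace E]
  [Finite ι] (b : Module.Basis ι ℝ E) (μ : Measure E) [μ.IsAddHaarMeasure]

/-- The translates of the fundamental domain by the points of `Z` are pairwise disjoint and stay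
within distance `d` of these points, hence inside `V`. -/
theorem card_mul_measure_fundamentalDomain_le {d : ℝ}
    (hd : ∀ x ∈ ZSpan.fundamentalDomain b, ‖x‖ ≤ d) {Z : Finset E} {V : Set E}
    (hZ : ∀ z ∈ Z, z ∈ Submodule.span ℤ (Set.range b)) (hV : ∀ z ∈ Z, Metric.closedBall z d ⊆ V) :
    Z.card * μ (ZSpan.fundamentalDomain b) ≤ μ V := by
  have : FiniteDimensional ℝ E := b.finiteDimensional_of_finite
  have hm := ZSpan.fundamentalDomain_measurableSet b
  have hsub : (⋃ z ∈ Z, z +ᵥ ZSpan.fundamentalDomain b) ⊆ V := by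
    simp only [Set.iUnion_subset_iff]
    rintro z hz _ ⟨x, hx, rfl⟩
    refine hV z hz ?_
    simpa using hd x hx
  refine le_trans (le_of_eq ?_) (measure_mono hsub)
  rw [measure_biUnion_finset]
  · simp
  · intro z hz w hw hzw
    refine Set.disjoint_left.mpr ?_
    rintro _ ⟨x, hx, rfl⟩ ⟨y, hy, hxy⟩
    simp only [vadd_eq_add] at hxy
    -- Both `-z` and `-w` carry the common point into the fundamental domain; uniqueness forces `z =
    -- w`.
    obtain ⟨u, -, hu⟩ := ZSpan.exist_unique_vadd_mem_fundamentalDomain b (z + x)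
    have h1 := hu ⟨-z, neg_mem (hZ z hz)⟩ (by simpa [Submodule.vadd_def] using hx)
    have h2 := hu ⟨-w, neg_mem (hZ w hw)⟩ (by
      rw [← hxy]; simpa [Submodule.vadd_def] using hy)
    have := congrArg Subtype.val (h1.trans h2.symm)
    exact hzw (neg_injective this)
  · intro z _
    exact hm.const_vadd z

theorem measure_le_card_mul_measure_fundamentalDomain {d : ℝ}
    (hd : ∀ x ∈ ZSpan.fundamentalDomain b, ‖x‖ ≤ d) {Z : Finset E} {V : Set E}
    (hV : ∀ x ∈ V, ∀ z ∈ Submodule.span ℤ (Set.range b), dist z x ≤ d → z ∈ Z) :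
    μ V ≤ Z.card * μ (ZSpan.fundamentalDomain b) := by
  have : FiniteDimensional ℝ E := b.finiteDimensional_of_finite
  have hsub : V ⊆ ⋃ z ∈ Z, z +ᵥ ZSpan.fundamentalDomain b := by
    intro x hx
    obtain ⟨u, hu, -⟩ := ZSpan.exist_unique_vadd_mem_fundamentalDomain b x
    simp only [Submodule.vadd_def, vadd_eq_add] at hu
    refine Set.mem_biUnion (x := -(u : E)) (hV x hx _ (neg_mem u.2) ?_) ⟨_, hu, by simp⟩
    rw [dist_comm, dist_eq_norm, sub_neg_eq_add, add_comm]
    exact hd _ hu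
  refine (measure_mono hsub).trans ((measure_biUnion_finset_le _ _).trans (le_of_eq ?_))
  simp

end Counting

/-! ### Counting in products `A × B`, and the density of `A_W`. -/

/-- The coordinates of the points `x ∈ ℤ[ζ]` with `x ∈ A` and `σ x ∈ B`. -/
def latticeSet (A B : Set ℂ) : Set (ℤ√2 × ℤ√2) := {q | cycl q ∈ A ∧ cyclStar q ∈ B}

theorem prod_cycl_cyclStar_injective :
    Function.Injective fun q : ℤ√2 × ℤ√2 => (cycl q, cyclStar q) :=
  fun _ _ h => cycl_injective (congrArg Prod.fst h)

theorem latticeSet_finite {A B : Set ℂ} (hA : Bornology.IsBounded A) (hB : Bornology.IsBounded B) :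
    (latticeSet A B).Finite := by
  refine ((ZSpan.setFinite_inter latticeBasis (hA.prod hB)).preimage
    prod_cycl_cyclStar_injective.injOn).subset ?_
  rintro q ⟨h1, h2⟩
  exact ⟨⟨h1, h2⟩, mem_span_latticeBasis.mpr ⟨q, rfl⟩⟩

/-- The measure of the closed `ε`-neighbourhood of `A`. -/
noncomputable def outerVol (A : Set ℂ) (ε : ℝ) : ℝ := volume.real (Metric.cthickening ε A)

/-- The measure of the set of points of `A` at distance more than `ε` from the complement. -/
noncomputable def innerVol (A : Set ℂ) (ε : ℝ) : ℝ :=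
  volume.real (A \ Metric.cthickening ε Aᶜ)

theorem outerVol_nonneg (A : Set ℂ) (ε : ℝ) : 0 ≤ outerVol A ε := measureReal_nonneg

/-- The point is that `d` does not depend on `A` and `B`: when both are dilated by large factors,
`d` becomes negligible relative to them. -/
theorem exists_counting_bounds : ∃ d > 0, ∀ A B : Set ℂ, Bornology.IsBounded A →
    Bornology.IsBounded B →
    4 * ((latticeSet A B).ncard : ℝ) ≤ outerVol A d * outerVol B d ∧
    innerVol A d * innerVol B d ≤ 4 * ((latticeSet A B).ncard : ℝ) := by
  obtain ⟨d, hd0, hd⟩ := (ZSpan.fundamentalDomain_isBounded latticeBasis).exists_pos_norm_le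
  refine ⟨d, hd0, fun A B hA hB => ?_⟩
  have hfin := latticeSet_finite hA hB
  set Z : Finset (ℂ × ℂ) := hfin.toFinset.map ⟨_, prod_cycl_cyclStar_injective⟩ with hZ
  have hcard : Z.card = (latticeSet A B).ncard := by
    rw [hZ, Finset.card_map, Set.ncard_eq_toFinset_card _ hfin]
  have hmem (z : ℂ × ℂ) : z ∈ Z ↔ ∃ q, q ∈ latticeSet A B ∧ (cycl q, cyclStar q) = z := by
    simp [hZ]
  rw [← hcard]
  constructor
  · have h := card_mul_measure_fundamentalDomain_le latticeBasis volume hd (Z := Z)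
      (V := Metric.cthickening d A ×ˢ Metric.cthickening d B) ?_ ?_
    · rw [volume_fundamentalDomain_latticeBasis, Measure.volume_eq_prod, Measure.prod_prod] at h
      have h2 := ENNReal.toReal_mono (ENNReal.mul_ne_top hA.cthickening.measure_lt_top.ne
        hB.cthickening.measure_lt_top.ne) h
      simp only [ENNReal.toReal_mul, ENNReal.toReal_natCast, ENNReal.toReal_ofNat] at h2
      rw [mul_comm]
      exact h2
    · intro z hz
      obtain ⟨q, -, rfl⟩ := (hmem z).mp hz
      exact mem_span_latticeBasis.mpr ⟨q, rfl⟩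
    · intro z hz
      obtain ⟨q, hq, rfl⟩ := (hmem z).mp hz
      rintro ⟨x, y⟩ hxy
      rw [Metric.mem_closedBall, Prod.dist_eq, max_le_iff] at hxy
      exact ⟨Metric.mem_cthickening_of_dist_le _ _ _ _ hq.1 hxy.1,
        Metric.mem_cthickening_of_dist_le _ _ _ _ hq.2 hxy.2⟩
  · have h := measure_le_card_mul_measure_fundamentalDomain latticeBasis volume hd (Z := Z)
      (V := (A \ Metric.cthickening d Aᶜ) ×ˢ (B \ Metric.cthickening d Bᶜ)) ?_
    · rw [volume_fundamentalDomain_latticeBasis, Measure.volume_eq_prod, Measure.prod_prod] at h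
      have h2 := ENNReal.toReal_mono (ENNReal.mul_ne_top (ENNReal.natCast_ne_top _)
        (by norm_num)) h
      simp only [ENNReal.toReal_mul, ENNReal.toReal_natCast, ENNReal.toReal_ofNat] at h2
      rw [mul_comm (4 : ℝ)]
      exact h2
    · rintro ⟨x, y⟩ ⟨hx, hy⟩ z hz hzx
      obtain ⟨q, rfl⟩ := mem_span_latticeBasis.mp hz
      rw [dist_comm, Prod.dist_eq, max_le_iff] at hzx
      refine (hmem _).mpr ⟨q, ⟨?_, ?_⟩, rfl⟩
      · by_contra h
        exact hx.2 (Metric.mem_cthickening_of_dist_le _ _ _ _ h hzx.1)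
      · by_contra h
        exact hy.2 (Metric.mem_cthickening_of_dist_le _ _ _ _ h hzx.2)

/-- Multiplication by a unit permutes `ℤ[ζ]`. It serves to shift scale from one factor of `A × B` to
the other. -/
theorem ncard_latticeSet_unit_smul (u : (ℤ√2)ˣ) (A B : Set ℂ) :
    (latticeSet (emb u • A) (embConj u • B)).ncard = (latticeSet A B).ncard := by
  have h1 : emb u ≠ 0 := emb_eq_zero.not.mpr u.ne_zero
  have h2 : embConj u ≠ 0 := embConj_eq_zero.not.mpr u.ne_zero
  have : latticeSet (emb u • A) (embConj u • B) = (fun q => (u : ℤ√2) • q) '' latticeSet A B := by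
    ext q
    constructor
    · intro ⟨hA, hB⟩
      have hq : (u : ℤ√2) • ((↑u⁻¹ : ℤ√2) • q) = q := by
        rw [smul_smul, Units.mul_inv, one_smul]
      rw [← hq, cycl_smul, Set.smul_mem_smul_set_iff₀ h1] at hA
      rw [← hq, cyclStar_smul, Set.smul_mem_smul_set_iff₀ h2] at hB
      exact ⟨_, ⟨hA, hB⟩, hq⟩
    · rintro ⟨q, ⟨hA, hB⟩, rfl⟩
      refine ⟨?_, ?_⟩
      · rw [cycl_smul]
        exact Set.smul_mem_smul_set hA
      · rw [cyclStar_smul]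
        exact Set.smul_mem_smul_set hB
  rw [this, Set.ncard_image_of_injective _ fun p q h => ?_]
  have := congrArg (fun q => (↑u⁻¹ : ℤ√2) • q) h
  simpa [smul_smul] using this

theorem volume_real_smul (s : ℝ) (A : Set ℂ) : volume.real (s • A) = s ^ 2 * volume.real A := by
  rw [measureReal_def, Measure.addHaar_smul, Complex.finrank_real_complex, ENNReal.toReal_mul,
    ENNReal.toReal_ofReal (abs_nonneg _), abs_of_nonneg (sq_nonneg s), measureReal_def]

theorem cthickening_smul {s : ℝ} (hs : s ≠ 0) (d : ℝ) (A : Set ℂ) :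
    Metric.cthickening d (s • A) = s • Metric.cthickening (d / |s|) A := by
  ext x
  have hx : x = s • (s⁻¹ • x) := by rw [smul_smul, mul_inv_cancel₀ hs, one_smul]
  have hs' : (‖s‖₊ : ENNReal) ≠ 0 := by simpa using hs
  rw [hx, Set.smul_mem_smul_set_iff₀ hs, Metric.mem_cthickening_iff, Metric.mem_cthickening_iff,
    infEDist_smul₀ hs, ENNReal.ofReal_div_of_pos (abs_pos.mpr hs), ENNReal.smul_def, smul_eq_mul,
    ENNReal.le_div_iff_mul_le (by simp [hs]) (by simp), mul_comm, ← Real.norm_eq_abs, ofReal_norm]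
  rfl

theorem outerVol_smul {s : ℝ} (hs : s ≠ 0) (d : ℝ) (A : Set ℂ) :
    outerVol (s • A) d = s ^ 2 * outerVol A (d / |s|) := by
  rw [outerVol, cthickening_smul hs, volume_real_smul, outerVol]

theorem innerVol_smul {s : ℝ} (hs : s ≠ 0) (d : ℝ) (A : Set ℂ) :
    innerVol (s • A) d = s ^ 2 * innerVol A (d / |s|) := by
  have h : (s • A)ᶜ = s • Aᶜ := by
    simp only [Set.compl_eq_univ_sdiff, Set.smul_set_sdiff₀ hs, Set.smul_set_univ₀ hs]
  rw [innerVol, h, cthickening_smul hs, ← Set.smul_set_sdiff₀ hs,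
    volume_real_smul, innerVol]

theorem JordanMeasurable.volume_closure {A : Set ℂ} (hA : JordanMeasurable A) :
    volume (closure A) = volume A := by
  refine le_antisymm ?_ (measure_mono subset_closure)
  rw [closure_eq_self_union_frontier]
  refine (measure_union_le _ _).trans ?_
  rw [hA.2, add_zero]

theorem JordanMeasurable.tendsto_outerVol {A : Set ℂ} (hA : JordanMeasurable A) :
    Tendsto (outerVol A) (𝓝 0) (𝓝 (volume.real A)) := by
  have h := tendsto_measure_cthickening (μ := (volume : Measure ℂ)) (s := A)
    ⟨1, one_pos, hA.1.cthickening.measure_lt_top.ne⟩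
  rw [hA.volume_closure] at h
  exact (ENNReal.tendsto_toReal hA.1.measure_lt_top.ne).comp h

theorem JordanMeasurable.tendsto_innerVol {A : Set ℂ} (hA : JordanMeasurable A) :
    Tendsto (innerVol A) (𝓝 0) (𝓝 (volume.real A)) := by
  have hfin : volume A ≠ ⊤ := hA.1.measure_lt_top.ne
  have : Fact (volume A < ⊤) := ⟨hA.1.measure_lt_top⟩
  -- Neighbourhoods of the complement are measured inside `A`: they shrink to `A ∩ closure Aᶜ`, a
  -- part of the null frontier.
  have h := tendsto_measure_cthickening (μ := (volume.restrict A : Measure ℂ)) (s := Aᶜ)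
    ⟨1, one_pos, measure_ne_top _ _⟩
  have h0 : volume.restrict A (closure Aᶜ) = 0 := by
    rw [Measure.restrict_apply isClosed_closure.measurableSet]
    refine measure_mono_null ?_ hA.2
    rintro x ⟨h1, h2⟩
    rw [frontier_eq_closure_inter_closure]
    exact ⟨subset_closure h2, h1⟩
  rw [h0] at h
  have h2 := (ENNReal.tendsto_toReal (by simp)).comp h
  have h3 : Tendsto (fun r => volume.real A -
      (volume.restrict A (Metric.cthickening r Aᶜ)).toReal) (𝓝 0) (𝓝 (volume.real A)) := by
    simpa using h2.const_sub (volume.real A)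
  refine h3.congr fun r => ?_
  have hm := (Metric.isClosed_cthickening (δ := r) (E := Aᶜ)).measurableSet
  rw [Measure.restrict_apply hm, innerVol, measureReal_def, measureReal_def,
    ← measure_inter_add_sdiff A hm, ENNReal.toReal_add, Set.inter_comm]
  · ring
  · exact measure_ne_top_of_subset Set.inter_subset_left hfin
  · exact measure_ne_top_of_subset Set.sdiff_subset hfin

theorem ASet_inter (W X : Set ℂ) : ASet W ∩ X = cycl '' latticeSet X W := by
  rw [ASet_eq]
  ext z
  constructor
  · rintro ⟨⟨q, hq, rfl⟩, hz⟩
    exact ⟨q, ⟨hz, hq⟩, rfl⟩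
  · rintro ⟨q, ⟨hz, hq⟩, rfl⟩
    exact ⟨⟨q, hq, rfl⟩, hz⟩

theorem ncard_ASet_inter (W X : Set ℂ) : (ASet W ∩ X).ncard = (latticeSet X W).ncard := by
  rw [ASet_inter, Set.ncard_image_of_injective _ cycl_injective]

theorem embConj_lamUnit_zpow (n : ℤ) : embConj ↑(lamUnit ^ n) = (-lam⁻¹) ^ n := by
  have : Units.map (embConj : ℤ√2 →* ℝ) (lamUnit ^ n) =
    (Units.map (embConj : ℤ√2 →* ℝ) lamUnit) ^ n := map_zpow _ _ _
  have h := congrArg Units.val this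
  rw [Units.val_zpow_eq_zpow_val] at h
  exact h.trans (congrArg (· ^ n) embConj_lamUnit)

/-- In `T D × W` the second factor does not grow, so boundary errors would persist. Multiplying by
`lamUnit ^ (-n)` with `lam ^ n` about `√T` turns it into a product whose two dilation factors both
tend to infinity. -/
theorem hasDensity_ASet {W : Set ℂ} (hW : JordanMeasurable W) :
    HasDensity (ASet W) (volume.real W / 4) := by
  have hl : 0 < lam := one_pos.trans one_lt_lam
  refine ⟨fun B hB => ?_, fun D hD hD0 => ?_⟩
  · rw [ASet_inter]
    exact (latticeSet_finite hB hW.1).image _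
  have hD0' : 0 < volume.real D := ENNReal.toReal_pos hD0.ne' hD.1.measure_lt_top.ne
  obtain ⟨d, hd, hbound⟩ := exists_counting_bounds
  -- The choice gives `lam ^ (2 n) ≤ T`, so both `lam ^ n` and `T / lam ^ n` are unbounded.
  set n : ℝ → ℕ := fun T => ⌊Real.logb lam T / 2⌋₊ with hn
  have hnt : Tendsto n atTop atTop := tendsto_nat_floor_atTop.comp
    ((Real.tendsto_logb_atTop one_lt_lam).atTop_div_const two_pos)
  have hpow : Tendsto (fun T => lam ^ n T) atTop atTop :=
    (tendsto_pow_atTop_atTop_of_one_lt one_lt_lam).comp hnt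
  have hle : ∀ᶠ T : ℝ in atTop, lam ^ n T ≤ T / lam ^ n T := by
    filter_upwards [eventually_ge_atTop 1] with T hT
    rw [le_div_iff₀ (by positivity), ← pow_add, ← two_mul, ← Real.rpow_natCast,
      ← Real.le_logb_iff_rpow_le one_lt_lam (by linarith)]
    have := Nat.floor_le (div_nonneg (Real.logb_nonneg one_lt_lam hT) two_pos.le)
    push_cast
    linarith
  have hpow' : Tendsto (fun T => T / lam ^ n T) atTop atTop := tendsto_atTop_mono' _ hle hpow
  have hε : Tendsto (fun T => d / |T / lam ^ n T|) atTop (𝓝 0) :=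
    Tendsto.const_div_atTop (tendsto_abs_atTop_atTop.comp hpow') _
  have hε' : Tendsto (fun T => d / |(-lam) ^ n T|) atTop (𝓝 0) := by
    simp_rw [abs_pow, abs_neg, abs_of_pos hl]
    exact Tendsto.const_div_atTop hpow _
  have hscale (T : ℝ) : (latticeSet (T • D) W).ncard =
      (latticeSet ((T / lam ^ n T) • D) ((-lam) ^ n T • W)).ncard := by
    rw [← ncard_latticeSet_unit_smul (lamUnit ^ (-(n T : ℤ))), emb_lamUnit_zpow,
      embConj_lamUnit_zpow, smul_smul, zpow_neg, zpow_natCast, zpow_neg, zpow_natCast, ← inv_pow,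
      ← inv_pow, inv_neg, inv_inv, inv_pow, ← div_eq_inv_mul]
  have hcount (T : ℝ) (hT : 0 < T) :
      4 * (((ASet W ∩ T • D).ncard : ℝ) / volume.real (T • D)) ≤
        outerVol D (d / |T / lam ^ n T|) * outerVol W (d / |(-lam) ^ n T|) / volume.real D ∧
      innerVol D (d / |T / lam ^ n T|) * innerVol W (d / |(-lam) ^ n T|) / volume.real D ≤
        4 * (((ASet W ∩ T • D).ncard : ℝ) / volume.real (T • D)) := by
    have h1 : T / lam ^ n T ≠ 0 := by positivity
    have h2 : (-lam) ^ n T ≠ 0 := pow_ne_zero _ (neg_ne_zero.mpr hl.ne')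
    have h3 : ((-lam) ^ n T) ^ 2 = (lam ^ n T) ^ 2 := by
      rw [← pow_mul, mul_comm, pow_mul, neg_sq, ← pow_mul, mul_comm, pow_mul]
    have hb := hbound ((T / lam ^ n T) • D) ((-lam) ^ n T • W) (hD.1.smul₀ _) (hW.1.smul₀ _)
    rw [ncard_ASet_inter, hscale, volume_real_smul, ← mul_div_assoc, div_le_div_iff₀ (by positivity)
      (by positivity), div_le_div_iff₀ (by positivity) (by positivity)]
    rw [outerVol_smul h1, outerVol_smul h2, innerVol_smul h1, innerVol_smul h2, h3] at hb
    have e (x y : ℝ) : (T / lam ^ n T) ^ 2 * x * ((lam ^ n T) ^ 2 * y) = T ^ 2 * (x * y) := by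
      field_simp
    rw [e, e] at hb
    constructor
    · nlinarith [hb.1]
    · nlinarith [hb.2]
  have hlim : Tendsto (fun T : ℝ => 4 * (((ASet W ∩ T • D).ncard : ℝ) / volume.real (T • D)))
      atTop (𝓝 (volume.real D * volume.real W / volume.real D)) := by
    refine tendsto_of_tendsto_of_tendsto_of_le_of_le'
      (((hD.tendsto_innerVol.comp hε).mul (hW.tendsto_innerVol.comp hε')).div_const _)
      (((hD.tendsto_outerVol.comp hε).mul (hW.tendsto_outerVol.comp hε')).div_const _) ?_ ?_
    · filter_upwards [eventually_gt_atTop 0] with T hT using (hcount T hT).2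
    · filter_upwards [eventually_gt_atTop 0] with T hT using (hcount T hT).1
  rw [mul_div_cancel_left₀ _ hD0'.ne'] at hlim
  simpa using hlim.div_const 4

/-! ### Densities of finite intersections and finite differences. -/

theorem exists_quotElem {c : ℝ} (hc : c ∈ quotC) : ∃ γ : ℤ√2, emb γ = c ∧
    ((Prime γ ∧ c < lam) ∨ (γ = lamUnit ∧ c = lam)) := by
  rcases hc with hc | rfl
  · obtain ⟨p, hp, h, -, h2⟩ := mem_primesP.mp hc
    exact ⟨p, h, Or.inl ⟨hp, h2⟩⟩
  · exact ⟨lamUnit, emb_lamUnit, Or.inr ⟨rfl, rfl⟩⟩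

/-- The element of `ℤ[√2]` given by a number in `C`. -/
noncomputable def quotElem (c : quotC) : ℤ√2 := (exists_quotElem c.2).choose

theorem emb_quotElem (c : quotC) : emb (quotElem c) = c := (exists_quotElem c.2).choose_spec.1

theorem quotElem_cases (c : quotC) : (Prime (quotElem c) ∧ (c : ℝ) < lam) ∨
    (quotElem c = lamUnit ∧ (c : ℝ) = lam) :=
  (exists_quotElem c.2).choose_spec.2

theorem quotElem_ne_zero (c : quotC) : quotElem c ≠ 0 := by
  rw [Ne, ← emb_eq_zero, emb_quotElem]
  exact (one_pos.trans (one_lt_of_mem_quotC c.2)).ne'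

theorem isCoprime_of_isUnit_left {R : Type*} [CommRing R] {x : R} (hx : IsUnit x) (y : R) :
    IsCoprime x y := by
  obtain ⟨u, rfl⟩ := hx
  exact ⟨↑u⁻¹, 0, by simp⟩

/-- Distinct primes in `[1, lam)` are not associated, and `lam` is a unit, coprime to everything. -/
theorem isCoprime_quotElem {c c' : quotC} (h : c ≠ c') :
    IsCoprime (quotElem c) (quotElem c') := by
  rcases quotElem_cases c with ⟨hp, hl⟩ | ⟨hu, -⟩
  · rcases quotElem_cases c' with ⟨hp', hl'⟩ | ⟨hu', -⟩
    · rw [hp.irreducible.coprime_iff_not_dvd]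
      intro hdvd
      refine h (Subtype.ext ?_)
      rw [← emb_quotElem c, ← emb_quotElem c']
      refine congrArg emb (eq_of_associated_of_mem_Ico ((hp.dvd_prime_iff_associated hp').mp hdvd)
        ?_ ?_)
      · rw [emb_quotElem]
        exact ⟨(one_lt_of_mem_quotC c.2).le, hl⟩
      · rw [emb_quotElem]
        exact ⟨(one_lt_of_mem_quotC c'.2).le, hl'⟩
    · rw [hu']
      exact (isCoprime_of_isUnit_left lamUnit.isUnit _).symm
  · rw [hu]
    exact isCoprime_of_isUnit_left lamUnit.isUnit _

theorem cycl_mem_emb_smul_ASet {γ : ℤ√2} {W : Set ℂ} {q : ℤ√2 × ℤ√2} :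
    cycl q ∈ emb γ • ASet W ↔ ∃ q', q = γ • q' ∧ cyclStar q' ∈ W := by
  rw [ASet_eq]
  constructor
  · rintro ⟨_, ⟨q', hq', rfl⟩, h⟩
    simp only at h
    rw [← cycl_smul] at h
    exact ⟨q', (cycl_injective h).symm, hq'⟩
  · rintro ⟨q', rfl, hq'⟩
    rw [cycl_smul]
    exact Set.smul_mem_smul_set ⟨q', hq', rfl⟩

/-- The factor by which intersecting with `c A_W` changes the density of `A_W`. -/
noncomputable def quotFactor (c : quotC) : ℝ :=
  if (c : ℝ) = lam then (lam ^ 2)⁻¹ else (((quotElem c).norm : ℝ) ^ 2)⁻¹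

theorem emb_smul_ASet_eq {γ : ℤ√2} (W : Set ℂ) (hγ : γ ≠ 0) :
    emb γ • ASet ((embConj γ)⁻¹ • W) = cycl '' {q | (γ ∣ q.1 ∧ γ ∣ q.2) ∧ cyclStar q ∈ W} := by
  have h0 : embConj γ ≠ 0 := embConj_eq_zero.not.mpr hγ
  ext z
  constructor
  · rintro ⟨z, hz, rfl⟩
    rw [ASet_eq] at hz
    obtain ⟨q, hq, rfl⟩ := hz
    refine ⟨γ • q, ⟨⟨Dvd.intro _ rfl, Dvd.intro _ rfl⟩, ?_⟩, by simp only [cycl_smul]⟩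
    rw [cyclStar_smul]
    have hq' : cyclStar q ∈ (embConj γ)⁻¹ • W := hq
    rwa [Set.mem_inv_smul_set_iff₀ h0] at hq'
  · rintro ⟨q, ⟨⟨⟨a, ha⟩, ⟨b, hb⟩⟩, hq⟩, rfl⟩
    have hqq : q = γ • (a, b) := Prod.ext ha hb
    rw [cycl_mem_emb_smul_ASet]
    refine ⟨_, hqq, ?_⟩
    rwa [Set.mem_inv_smul_set_iff₀ h0, ← cyclStar_smul, ← hqq]

theorem IsWindow.cyclStar_mem_of_prime {W : Set ℂ} (hW : IsWindow W) {γ : ℤ√2} {q : ℤ√2 × ℤ√2}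
    (h1 : 1 < emb γ) (h2 : emb γ < lam) (h : cyclStar (γ • q) ∈ W) : cyclStar q ∈ W := by
  have hc := embConj_of_emb_mem_Ioo_one_lam h1 h2
  have := hW.inv_smul_mem h hc
  rwa [cyclStar_smul, smul_smul, inv_mul_cancel₀, one_smul] at this
  rw [Ne, embConj_eq_zero, ← emb_eq_zero]
  exact (one_pos.trans h1).ne'

theorem inv_lam_smul_mem {W : Set ℂ} (hW : IsWindow W) {w : ℂ} (hw : w ∈ W) :
    (-lam⁻¹) • w ∈ W := by
  rw [← inv_neg]
  refine hW.inv_smul_mem hw (Or.inr ?_)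
  rw [lam]
  linarith

-- By coprimality, divisibility by each `c` is divisibility by the product. For a prime the window
-- condition on the quotient is automatic. For the unit `lam` it is the reverse: divisibility is
-- void, and the window shrinks to `-lam⁻¹ W ⊆ W`.
open Classical in
theorem multiIntersection_eq {W : Set ℂ} (hW : IsWindow W) (F : Finset quotC) :
    multiIntersection (ASet W) F = emb (∏ c ∈ F, quotElem c) •
      ASet ((embConj (∏ c ∈ F, quotElem c))⁻¹ •
        (if ⟨lam, lam_mem_quotC⟩ ∈ F then (-lam⁻¹) • W else W)) := by
  have hl : -lam⁻¹ ≠ 0 := neg_ne_zero.mpr (inv_ne_zero (one_pos.trans one_lt_lam).ne')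
  rw [emb_smul_ASet_eq _ (Finset.prod_ne_zero_iff.mpr fun c _ => quotElem_ne_zero c)]
  ext z
  constructor
  · rintro ⟨hz, hzF⟩
    rw [ASet_eq] at hz
    obtain ⟨q, hq, rfl⟩ := hz
    have hF : ∀ c ∈ F, ∃ q', q = quotElem c • q' ∧ cyclStar q' ∈ W := by
      intro c hc
      rw [← cycl_mem_emb_smul_ASet, emb_quotElem]
      exact Set.mem_iInter₂.mp hzF c hc
    refine ⟨q, ⟨⟨?_, ?_⟩, ?_⟩, rfl⟩
    · refine Finset.prod_dvd_of_coprime (fun c _ c' _ h => isCoprime_quotElem h) fun c hc => ?_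
      obtain ⟨q', rfl, -⟩ := hF c hc
      exact Dvd.intro _ rfl
    · refine Finset.prod_dvd_of_coprime (fun c _ c' _ h => isCoprime_quotElem h) fun c hc => ?_
      obtain ⟨q', rfl, -⟩ := hF c hc
      exact Dvd.intro _ rfl
    · split_ifs with hlam
      · obtain ⟨q', rfl, hq'⟩ := hF _ hlam
        rcases quotElem_cases ⟨lam, lam_mem_quotC⟩ with ⟨-, h⟩ | ⟨h, -⟩
        · exact absurd h (lt_irrefl _)
        · rw [h, cyclStar_smul, embConj_lamUnit]
          exact Set.smul_mem_smul_set hq'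
      · exact hq
  · rintro ⟨q, ⟨⟨h1, h2⟩, hq⟩, rfl⟩
    have hqW : cyclStar q ∈ W := by
      split_ifs at hq with hlam
      · obtain ⟨w, hw, hwq⟩ := hq
        rw [← hwq]
        exact inv_lam_smul_mem hW hw
      · exact hq
    refine ⟨cycl_mem_ASet.mpr hqW, Set.mem_iInter₂.mpr fun c hc => ?_⟩
    obtain ⟨a, ha⟩ := (Finset.dvd_prod_of_mem _ hc).trans h1
    obtain ⟨b, hb⟩ := (Finset.dvd_prod_of_mem _ hc).trans h2
    obtain rfl : q = quotElem c • (a, b) := Prod.ext ha hb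
    rw [← emb_quotElem, cycl_mem_emb_smul_ASet]
    refine ⟨_, rfl, ?_⟩
    rcases quotElem_cases c with ⟨-, hcl⟩ | ⟨hu, hcl⟩
    · exact hW.cyclStar_mem_of_prime (by rw [emb_quotElem]; exact one_lt_of_mem_quotC c.2)
        (by rwa [emb_quotElem]) hqW
    · have hmem : (⟨lam, lam_mem_quotC⟩ : quotC) ∈ F := by
        convert hc
        exact hcl.symm
      rw [if_pos hmem, hu, cyclStar_smul, embConj_lamUnit, Set.smul_mem_smul_set_iff₀ hl] at hq
      exact hq

theorem JordanMeasurable.smul {W : Set ℂ} (hW : JordanMeasurable W) {r : ℝ} (hr : r ≠ 0) :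
    JordanMeasurable (r • W) := by
  refine ⟨hW.1.smul₀ r, ?_⟩
  have h : frontier (r • W) = r • frontier W :=
    ((Homeomorph.smulOfNeZero r hr).image_frontier W).symm
  rw [h, Measure.addHaar_smul, hW.2, mul_zero]

theorem HasDensity.smul {P : Set ℂ} {θ : ℝ} (hP : HasDensity P θ) {r : ℝ} (hr : 0 < r) :
    HasDensity (r • P) (θ / r ^ 2) := by
  have hinter (B : Set ℂ) : r • P ∩ B = r • (P ∩ r⁻¹ • B) := by
    rw [Set.smul_set_inter₀ hr.ne', smul_inv_smul₀ hr.ne']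
  refine ⟨fun B hB => ?_, fun D hD hD0 => ?_⟩
  · rw [hinter]
    exact (hP.1 _ (hB.smul₀ _)).smul_set
  · have h1 : Tendsto (fun T : ℝ => r⁻¹ * T) atTop atTop :=
      tendsto_id.const_mul_atTop (inv_pos.mpr hr)
    have h2 := ((hP.2 D hD hD0).comp h1).div_const (r ^ 2)
    refine h2.congr fun T => ?_
    simp only [Function.comp_apply]
    have hn : (r • (P ∩ (r⁻¹ * T) • D)).ncard = (P ∩ (r⁻¹ * T) • D).ncard :=
      Set.ncard_image_of_injective _ (smul_right_injective ℂ hr.ne')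
    rw [hinter, smul_smul, hn, volume_real_smul, volume_real_smul]
    field_simp

/-- For `Q = ∏ c`, scaling the plane by `Q` costs `Q²` and scaling the window by `1 / Q'` costs
`Q'²`, together `N(Q)²`. If `lam ∈ F`, the smaller window adds the factor `lam⁻²`. -/
theorem hasDensity_multiIntersection {W : Set ℂ} (hW : IsWindow W) (F : Finset quotC) :
    HasDensity (multiIntersection (ASet W) F)
      (volume.real W / 4 * ∏ c ∈ F, quotFactor c) := by
  classical
  have hl : lam ≠ 0 := (one_pos.trans one_lt_lam).ne'
  set Q : ℤ√2 := ∏ c ∈ F, quotElem c with hQ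
  have hQ0 : Q ≠ 0 := Finset.prod_ne_zero_iff.mpr fun c _ => quotElem_ne_zero c
  have h0 : embConj Q ≠ 0 := embConj_eq_zero.not.mpr hQ0
  have hQpos : 0 < emb Q := by
    rw [hQ, map_prod]
    refine Finset.prod_pos fun c _ => ?_
    rw [emb_quotElem]
    exact one_pos.trans (one_lt_of_mem_quotC c.2)
  have hl' : -lam⁻¹ ≠ 0 := neg_ne_zero.mpr (inv_ne_zero hl)
  have hprod : ∏ c ∈ F, quotFactor c =
      ((Q.norm : ℝ) ^ 2)⁻¹ * (if (⟨lam, lam_mem_quotC⟩ : quotC) ∈ F then (lam ^ 2)⁻¹ else 1) := by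
    have hfac (c : quotC) : quotFactor c = (((quotElem c).norm : ℝ) ^ 2)⁻¹ *
        (if c = (⟨lam, lam_mem_quotC⟩ : quotC) then (lam ^ 2)⁻¹ else 1) := by
      rw [quotFactor]
      by_cases hc : (c : ℝ) = lam
      · have hc' : c = ⟨lam, lam_mem_quotC⟩ := Subtype.ext hc
        rw [if_pos hc, if_pos hc']
        rcases quotElem_cases c with ⟨-, h⟩ | ⟨h, -⟩
        · exact absurd hc h.ne
        · rw [h]
          norm_num [lamUnit, Zsqrtd.norm_def]
      · have hc' : c ≠ ⟨lam, lam_mem_quotC⟩ := fun h => hc (congrArg Subtype.val h)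
        rw [if_neg hc, if_neg hc', mul_one]
    simp_rw [hfac]
    rw [Finset.prod_mul_distrib, Finset.prod_ite_eq', Finset.prod_inv_distrib, Finset.prod_pow]
    congr 3
    rw [hQ, ← Int.cast_prod]
    exact congrArg _ (map_prod Zsqrtd.normMonoidHom _ _).symm
  rw [multiIntersection_eq hW, hprod]
  have hN : (Q.norm : ℝ) = emb Q * embConj Q := (emb_mul_embConj Q).symm
  split_ifs with h
  · convert (hasDensity_ASet ((hW.1.smul hl').smul (inv_ne_zero h0))).smul hQpos using 1
    rw [volume_real_smul, volume_real_smul, hN]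
    field_simp
  · convert (hasDensity_ASet (hW.1.smul (inv_ne_zero h0))).smul hQpos using 1
    rw [volume_real_smul, hN]
    field_simp

theorem HasDensity.sdiff {X Y : Set ℂ} {x y : ℝ} (hX : HasDensity X x) (hY : HasDensity Y y)
    (h : X ⊆ Y) : HasDensity (Y \ X) (y - x) := by
  refine ⟨fun B hB => (hY.1 B hB).subset (Set.inter_subset_inter_left _ Set.sdiff_subset),
    fun D hD hD0 => ?_⟩
  refine ((hY.2 D hD hD0).sub (hX.2 D hD hD0)).congr fun T => ?_
  rw [← sub_div]
  congr 1
  have hsub : X ∩ T • D ⊆ Y ∩ T • D := Set.inter_subset_inter_left _ h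
  have hfin := hX.1 _ (hD.1.smul₀ T)
  have heq : (Y \ X) ∩ T • D = (Y ∩ T • D) \ (X ∩ T • D) := by
    ext z
    simp only [Set.mem_inter_iff, Set.mem_sdiff]
    tauto
  rw [heq, sub_eq_iff_eq_add]
  exact_mod_cast (Set.ncard_sdiff_add_ncard_of_subset hsub (hY.1 _ (hD.1.smul₀ T))).symm

/-- `F` varies in the induction because removing the dilate by `a` subtracts the part of the
previous set counted by `insert a F`. -/
theorem hasDensity_multiIntersection_sdiff {W : Set ℂ} (hW : IsWindow W) (F G : Finset quotC)
    (hFG : Disjoint F G) :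
    HasDensity (multiIntersection (ASet W) F \ ⋃ c ∈ G, (c : ℝ) • ASet W)
      (volume.real W / 4 * (∏ c ∈ F, quotFactor c) * ∏ c ∈ G, (1 - quotFactor c)) := by
  classical
  induction G using Finset.induction_on generalizing F with
  | empty => simpa using hasDensity_multiIntersection hW F
  | insert a G ha ih =>
    rw [Finset.disjoint_insert_right] at hFG
    have h1 := ih F hFG.2
    have h2 := ih (insert a F) (Finset.disjoint_insert_left.mpr ⟨ha, hFG.2⟩)
    have h3 := h2.sdiff h1 (by
      refine Set.sdiff_subset_sdiff_left ?_
      rintro z ⟨hz, hz'⟩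
      refine ⟨hz, Set.mem_iInter₂.mpr fun c hc => ?_⟩
      exact Set.mem_iInter₂.mp hz' c (Finset.mem_insert_of_mem hc))
    convert h3 using 1
    · ext z
      simp only [multiIntersection, Set.mem_sdiff, Set.mem_inter_iff, Set.mem_iInter,
        Set.mem_iUnion, Finset.mem_insert, forall_eq_or_imp, exists_prop, exists_eq_or_imp]
      generalize (z ∈ ASet W) = p
      generalize (z ∈ (a : ℝ) • ASet W) = p'
      generalize (∃ c ∈ G, z ∈ (c : ℝ) • ASet W) = p''
      tauto
    · rw [Finset.prod_insert ha, Finset.prod_insert hFG.1]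
      ring

/-! ### Uniform tail bounds and the density of the visible points. -/

/-- `|x|²` and `|σ x|²` are the two conjugates of an element of `ℤ[√2]`, so their product is a
positive integer. -/
theorem one_le_norm_cycl_mul_norm_cyclStar {q : ℤ√2 × ℤ√2} (hq : q ≠ 0) :
    1 ≤ ‖cycl q‖ * ‖cyclStar q‖ := by
  have hs : √2 * √2 = 2 := Real.mul_self_sqrt (by norm_num)
  set Z : ℤ√2 := q.1 ^ 2 + q.2 ^ 2 + ⟨0, 1⟩ * q.1 * q.2 with hZ
  have h1 : ‖cycl q‖ ^ 2 = emb Z := by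
    have h : (emb ⟨0, 1⟩ : ℝ) = √2 := by simp [emb_apply]
    rw [← Complex.normSq_eq_norm_sq, Complex.normSq_apply, cycl_re, cycl_im, hZ]
    simp only [map_add, map_mul, map_pow, h]
    linear_combination (emb q.2) ^ 2 / 2 * hs
  have h2 : ‖cyclStar q‖ ^ 2 = embConj Z := by
    have h : (embConj ⟨0, 1⟩ : ℝ) = -√2 := by simp [embConj_apply]
    rw [← Complex.normSq_eq_norm_sq, Complex.normSq_apply, cyclStar_re, cyclStar_im, hZ]
    simp only [map_add, map_mul, map_pow, h]
    linear_combination (embConj q.2) ^ 2 / 2 * hs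
  have h3 : (‖cycl q‖ * ‖cyclStar q‖) ^ 2 = Z.norm := by
    rw [mul_pow, h1, h2, emb_mul_embConj]
  have hZ0 : Z ≠ 0 := by
    intro h0
    rw [h0, map_zero] at h1
    have : cycl q = cycl 0 := by
      rw [cycl_zero]
      exact norm_eq_zero.mp (pow_eq_zero_iff two_ne_zero |>.mp h1)
    exact hq (cycl_injective this)
  have h4 : (0 : ℝ) ≤ Z.norm := h3 ▸ sq_nonneg _
  have h5 : 0 ≤ Z.norm := by exact_mod_cast h4
  have h6 : 1 ≤ Z.norm := by
    have := zsqrtd_norm_eq_zero.not.mpr hZ0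
    omega
  have h7 : (1 : ℝ) ≤ Z.norm := by exact_mod_cast h6
  rw [← h3] at h7
  exact (one_le_sq_iff₀ (by positivity)).mp h7

theorem outerVol_mono {A : Set ℂ} (hA : Bornology.IsBounded A) {ε δ : ℝ} (h : ε ≤ δ) :
    outerVol A ε ≤ outerVol A δ :=
  measureReal_mono (Metric.cthickening_mono h A) hA.cthickening.measure_lt_top.ne

/-- There is no boundary term, so the bound stays useful for small `r s`. If `r s < 1` no nonzero
point exists; otherwise a unit balances the two radii and the lattice count applies. -/
theorem exists_ncard_ne_zero_le : ∃ M : ℝ, 0 ≤ M ∧ ∀ r s : ℝ, 0 ≤ r → 0 ≤ s →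
    (({q | q ≠ 0 ∧ ‖cycl q‖ ≤ r ∧ ‖cyclStar q‖ ≤ s} : Set (ℤ√2 × ℤ√2)).ncard : ℝ) ≤
      M * (r * s) ^ 2 := by
  have hl : 0 < lam := one_pos.trans one_lt_lam
  obtain ⟨d, hd, hbound⟩ := exists_counting_bounds
  refine ⟨lam ^ 4 * outerVol (Metric.closedBall 0 1) d ^ 2 / 4, by positivity,
    fun r s hr hs => ?_⟩
  rcases lt_or_ge (r * s) 1 with hP | hP
  · have : ({q | q ≠ 0 ∧ ‖cycl q‖ ≤ r ∧ ‖cyclStar q‖ ≤ s} : Set (ℤ√2 × ℤ√2)) = ∅ := by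
      rw [Set.eq_empty_iff_forall_notMem]
      rintro q ⟨hq0, hqr, hqs⟩
      have h1 := one_le_norm_cycl_mul_norm_cyclStar hq0
      have h2 := mul_le_mul hqr hqs (norm_nonneg _) hr
      linarith
    rw [this, Set.ncard_empty, Nat.cast_zero]
    positivity
  · have hP0 : 0 < r * s := one_pos.trans_le hP
    have hr0 : 0 < r := pos_of_mul_pos_left hP0 hs
    set p := √(r * s) with hp
    have hp1 : 1 ≤ p := Real.one_le_sqrt.mpr hP
    have hpp : p * p = r * s := Real.mul_self_sqrt hP0.le
    -- Multiplying by `lam ^ n` takes `r` to at most `p` and `s` to less than `lam * p`, as `r s =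
    -- p²`.
    obtain ⟨n, hn1, hn2⟩ := exists_mem_Ico_zpow (show 0 < p / r by positivity) one_lt_lam
    have hpow : 0 < lam ^ n := zpow_pos hl n
    rw [le_div_iff₀ hr0] at hn1
    rw [div_lt_iff₀ hr0, zpow_add_one₀ hl.ne'] at hn2
    set ρ := lam * p with hρ
    have hρ1 : 1 ≤ ρ := by nlinarith [one_lt_lam]
    have hball : Metric.closedBall (0 : ℂ) ρ = ρ • Metric.closedBall (0 : ℂ) 1 := by
      rw [smul_closedBall' (by positivity), smul_zero, mul_one, Real.norm_of_nonneg (by positivity)]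
    have hcount := (hbound (Metric.closedBall 0 ρ) (Metric.closedBall 0 ρ)
      Metric.isBounded_closedBall Metric.isBounded_closedBall).1
    have hov : outerVol (Metric.closedBall (0 : ℂ) ρ) d ≤
        ρ ^ 2 * outerVol (Metric.closedBall 0 1) d := by
      rw [hball, outerVol_smul (by positivity)]
      refine mul_le_mul_of_nonneg_left (outerVol_mono Metric.isBounded_closedBall ?_) (sq_nonneg _)
      rw [abs_of_pos (by positivity)]
      exact div_le_self hd.le hρ1
    have hfin : (latticeSet (Metric.closedBall 0 r) (Metric.closedBall 0 s)).Finite :=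
      latticeSet_finite Metric.isBounded_closedBall Metric.isBounded_closedBall
    have hle1 : (({q | q ≠ 0 ∧ ‖cycl q‖ ≤ r ∧ ‖cyclStar q‖ ≤ s} : Set (ℤ√2 × ℤ√2)).ncard : ℝ) ≤
        (latticeSet (Metric.closedBall 0 r) (Metric.closedBall 0 s)).ncard := by
      refine Nat.cast_le.mpr (Set.ncard_le_ncard ?_ hfin)
      rintro q ⟨-, h1, h2⟩
      exact ⟨mem_closedBall_zero_iff.mpr h1, mem_closedBall_zero_iff.mpr h2⟩
    have hle2 : ((latticeSet (Metric.closedBall 0 r) (Metric.closedBall 0 s)).ncard : ℝ) ≤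
        (latticeSet (Metric.closedBall 0 ρ) (Metric.closedBall 0 ρ)).ncard := by
      rw [← ncard_latticeSet_unit_smul (lamUnit ^ n), emb_lamUnit_zpow, embConj_lamUnit_zpow]
      refine Nat.cast_le.mpr (Set.ncard_le_ncard ?_
        (latticeSet_finite Metric.isBounded_closedBall Metric.isBounded_closedBall))
      rw [smul_closedBall' (zpow_ne_zero _ hl.ne'),
        smul_closedBall' (zpow_ne_zero _ (by simpa using hl.ne')), smul_zero, smul_zero]
      rintro q ⟨h1, h2⟩
      refine ⟨Metric.closedBall_subset_closedBall ?_ h1, Metric.closedBall_subset_closedBall ?_ h2⟩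
      · rw [Real.norm_of_nonneg hpow.le]
        nlinarith [one_lt_lam]
      · rw [norm_zpow, norm_neg, norm_inv, Real.norm_of_nonneg hl.le, inv_zpow, inv_mul_le_iff₀ hpow]
        have h3 : p * p < (lam ^ n * lam * r) * p := by gcongr
        have h4 : r * s < r * (lam ^ n * ρ) := by
          rw [← hpp, hρ]
          linarith
        exact (lt_of_mul_lt_mul_left h4 hr0.le).le
    have hov0 := outerVol_nonneg (Metric.closedBall (0 : ℂ) ρ) d
    have hov2 := mul_le_mul hov hov hov0
      (mul_nonneg (sq_nonneg _) (outerVol_nonneg _ _))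
    have hfinal : ρ ^ 2 * outerVol (Metric.closedBall (0 : ℂ) 1) d *
        (ρ ^ 2 * outerVol (Metric.closedBall (0 : ℂ) 1) d) =
        4 * (lam ^ 4 * outerVol (Metric.closedBall 0 1) d ^ 2 / 4 * (r * s) ^ 2) := by
      rw [← hpp, hρ]
      ring
    linarith

theorem ncard_le_mul_tsum_of_subset_iUnion {α ι : Type*} {X : Set α} (hX : X.Finite)
    {U : ι → Set α} (hU : ∀ i, (U i).Finite) (hXU : X ⊆ ⋃ i, U i) {K : ℝ} (hK : 0 ≤ K)
    {h : ι → ℝ} (h0 : ∀ i, 0 ≤ h i) (hs : Summable h) (hb : ∀ i, ((U i).ncard : ℝ) ≤ K * h i) :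
    (X.ncard : ℝ) ≤ K * ∑' i, h i := by
  classical
  obtain ⟨I, hI, hXI⟩ := Set.finite_subset_iUnion hX hXU
  lift I to Finset ι using hI
  have h1 : X.ncard ≤ ∑ i ∈ I, (U i).ncard := by
    refine (Set.ncard_le_ncard hXI (Set.Finite.biUnion I.finite_toSet fun i _ => hU i)).trans ?_
    exact Finset.set_ncard_biUnion_le I U
  calc (X.ncard : ℝ) ≤ ∑ i ∈ I, ((U i).ncard : ℝ) := by exact_mod_cast h1
    _ ≤ ∑ i ∈ I, K * h i := Finset.sum_le_sum fun i _ => hb i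
    _ = K * ∑ i ∈ I, h i := (Finset.mul_sum _ _ _).symm
    _ ≤ K * ∑' i, h i := by
      gcongr
      exact hs.sum_le_tsum I fun i _ => h0 i

/-- The inverse square of the norm of an element of `C`. -/
noncomputable def invNormSq (c : quotC) : ℝ := (((quotElem c).norm : ℝ) ^ 2)⁻¹

theorem invNormSq_nonneg (c : quotC) : 0 ≤ invNormSq c := by
  rw [invNormSq]
  positivity

/-- Points of `c A_W` are multiples `γ q`, with `q` bounded by `T r / γ` and `σ q` by `s / |γ'|`.
The origin is left out, since it may lie in every dilate. -/
theorem exists_ncard_inter_smul_le {W D : Set ℂ} (hW : Bornology.IsBounded W)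
    (hD : Bornology.IsBounded D) : ∃ K : ℝ, 0 ≤ K ∧ ∀ (c : quotC) (T : ℝ), 0 < T →
      ((((ASet W ∩ (c : ℝ) • ASet W) ∩ T • D) \ {0}).ncard : ℝ) ≤ K * T ^ 2 * invNormSq c := by
  obtain ⟨M, hM, hbound⟩ := exists_ncard_ne_zero_le
  obtain ⟨r, hr, hDr⟩ := hD.exists_pos_norm_le
  obtain ⟨s, hs, hWs⟩ := hW.exists_pos_norm_le
  refine ⟨M * (r * s) ^ 2, by positivity, fun c T hT => ?_⟩
  set γ := quotElem c with hγ
  have hc : 0 < emb γ := by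
    rw [emb_quotElem]
    exact one_pos.trans (one_lt_of_mem_quotC c.2)
  have hc' : 0 < |embConj γ| := abs_pos.mpr (embConj_eq_zero.not.mpr (quotElem_ne_zero c))
  set Q : Set (ℤ√2 × ℤ√2) :=
    {q | q ≠ 0 ∧ ‖cycl q‖ ≤ T * r / emb γ ∧ ‖cyclStar q‖ ≤ s / |embConj γ|} with hQ
  have hQfin : Q.Finite := by
    refine (latticeSet_finite (A := Metric.closedBall 0 (T * r / emb γ))
      (B := Metric.closedBall 0 (s / |embConj γ|)) Metric.isBounded_closedBall
      Metric.isBounded_closedBall).subset ?_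
    rintro q ⟨-, h1, h2⟩
    exact ⟨mem_closedBall_zero_iff.mpr h1, mem_closedBall_zero_iff.mpr h2⟩
  have hsub : ((ASet W ∩ (c : ℝ) • ASet W) ∩ T • D) \ {0} ⊆ (fun q => cycl (γ • q)) '' Q := by
    rintro z ⟨⟨⟨hz1, hz2⟩, x, hx, hxz⟩, hz0⟩
    rw [ASet_eq] at hz1
    obtain ⟨p, hp, rfl⟩ := hz1
    rw [← emb_quotElem, cycl_mem_emb_smul_ASet] at hz2
    obtain ⟨q, rfl, -⟩ := hz2
    refine ⟨q, ⟨?_, ?_, ?_⟩, rfl⟩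
    · rintro rfl
      exact hz0 (by simp [cycl_zero])
    · rw [le_div_iff₀ hc, mul_comm]
      have h1 : ‖cycl (γ • q)‖ ≤ T * r := by
        rw [← hxz, norm_smul, Real.norm_of_nonneg hT.le]
        exact mul_le_mul_of_nonneg_left (hDr x hx) hT.le
      rwa [cycl_smul, norm_smul, Real.norm_of_nonneg hc.le] at h1
    · rw [le_div_iff₀ hc', mul_comm]
      have h1 := hWs _ hp
      rwa [cyclStar_smul, norm_smul, Real.norm_eq_abs] at h1
  calc ((((ASet W ∩ (c : ℝ) • ASet W) ∩ T • D) \ {0}).ncard : ℝ) ≤ Q.ncard := by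
        exact_mod_cast (Set.ncard_le_ncard hsub (hQfin.image _)).trans (Set.ncard_image_le hQfin)
    _ ≤ M * (T * r / emb γ * (s / |embConj γ|)) ^ 2 :=
        hbound _ _ (by positivity) (by positivity)
    _ = M * (r * s) ^ 2 * T ^ 2 * invNormSq c := by
        rw [invNormSq, ← hγ, ← emb_mul_embConj, mul_pow, div_pow, div_pow, sq_abs]
        have h1 := embConj_eq_zero.not.mpr (quotElem_ne_zero c)
        field_simp

theorem IsWindow.visiblePoints_eq {W : Set ℂ} (hW : IsWindow W) :
    visiblePoints (ASet W) = ASet W \ ⋃ c : quotC, (c : ℝ) • ASet W := by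
  ext x
  constructor
  · intro hx
    refine ⟨hx.1, fun h => ?_⟩
    obtain ⟨c, y, hy, hyx⟩ := Set.mem_iUnion.mp h
    have hc := one_lt_of_mem_quotC c.2
    have hc0 : 0 < (c : ℝ) := one_pos.trans hc
    refine hx.2 (c : ℝ)⁻¹ (by positivity) (inv_lt_one_of_one_lt₀ hc) ?_
    rwa [← hyx, inv_smul_smul₀ hc0.ne']
  · rintro ⟨hx, hxc⟩
    by_contra h
    obtain ⟨c, hc, hcx⟩ := hW.isOcclusionQuotients.2 x ⟨hx, h⟩
    have hc0 : 0 < c := one_pos.trans (one_lt_of_mem_quotC hc)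
    refine hxc (Set.mem_iUnion.mpr ⟨⟨c, hc⟩, _, hcx, ?_⟩)
    exact smul_inv_smul₀ hc0.ne' x

/-- The sets `S G` contain the visible points, and the excess is at most the origin plus a tail of
`∑ N(c)⁻²` times `K T²`. After division by `vol(T D)` the tail no longer depends on `T`, so `G` can
be fixed before `T` grows. -/
theorem hasDensity_visiblePoints {W : Set ℂ} (hW : IsWindow W) (hsum : Summable invNormSq) {θ : ℝ}
    (hθ : Tendsto (fun G : Finset quotC => volume.real W / 4 * ∏ c ∈ G, (1 - quotFactor c))
      atTop (𝓝 θ)) : HasDensity (visiblePoints (ASet W)) θ := by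
  have hA := hasDensity_ASet hW.1
  have hVA : visiblePoints (ASet W) ⊆ ASet W := fun x hx => hx.1
  refine ⟨fun B hB => (hA.1 B hB).subset (Set.inter_subset_inter_left _ hVA), fun D hD hD0 => ?_⟩
  have hD0' : 0 < volume.real D := ENNReal.toReal_pos hD0.ne' hD.1.measure_lt_top.ne
  obtain ⟨K, hK, hbound⟩ := exists_ncard_inter_smul_le hW.1.1 hD.1
  set S : Finset quotC → Set ℂ := fun G => ASet W \ ⋃ c ∈ G, (c : ℝ) • ASet W with hS
  have hSd (G : Finset quotC) : HasDensity (S G)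
      (volume.real W / 4 * ∏ c ∈ G, (1 - quotFactor c)) := by
    have h0 : multiIntersection (ASet W) (∅ : Finset quotC) = ASet W := by
      simp [multiIntersection]
    have h := hasDensity_multiIntersection_sdiff hW ∅ G (Finset.disjoint_empty_left G)
    rwa [h0, Finset.prod_empty, mul_one] at h
  have hVS (G : Finset quotC) : visiblePoints (ASet W) ⊆ S G := by
    rw [hW.visiblePoints_eq]
    exact Set.sdiff_subset_sdiff_right (Set.iUnion₂_subset fun c _ => Set.subset_iUnion_of_subset c
      subset_rfl)
  have hfin (X : Set ℂ) (hX : X ⊆ ASet W) (T : ℝ) : (X ∩ T • D).Finite :=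
    (hA.1 _ (hD.1.smul₀ T)).subset (Set.inter_subset_inter_left _ hX)
  have hdiff (G : Finset quotC) (T : ℝ) (hT : 0 < T) :
      ((S G ∩ T • D).ncard : ℝ) ≤ (visiblePoints (ASet W) ∩ T • D).ncard +
        (1 + K * T ^ 2 * ∑' c : {c // c ∉ G}, invNormSq c) := by
    have hcover : S G ∩ T • D ⊆ (visiblePoints (ASet W) ∩ T • D) ∪
        ({0} ∪ (((S G \ visiblePoints (ASet W)) ∩ T • D) \ {0})) := by
      rintro x ⟨hx, hxD⟩
      by_cases hxV : x ∈ visiblePoints (ASet W)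
      · exact Or.inl ⟨hxV, hxD⟩
      · by_cases hx0 : x = 0
        · exact Or.inr (Or.inl hx0)
        · exact Or.inr (Or.inr ⟨⟨⟨hx, hxV⟩, hxD⟩, hx0⟩)
    have hfin' : (((S G \ visiblePoints (ASet W)) ∩ T • D) \ {0}).Finite :=
      (hfin _ (fun x hx => hx.1.1) T).sdiff
    have h1 : (S G ∩ T • D).ncard ≤ (visiblePoints (ASet W) ∩ T • D).ncard +
        (1 + (((S G \ visiblePoints (ASet W)) ∩ T • D) \ {0}).ncard) := by
      refine (Set.ncard_le_ncard hcover ((hfin _ hVA T).union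
        ((Set.finite_singleton _).union hfin'))).trans ((Set.ncard_union_le _ _).trans ?_)
      gcongr
      refine (Set.ncard_union_le _ _).trans ?_
      rw [Set.ncard_singleton]
    have h2 : ((((S G \ visiblePoints (ASet W)) ∩ T • D) \ {0}).ncard : ℝ) ≤
        K * T ^ 2 * ∑' c : {c // c ∉ G}, invNormSq c := by
      refine ncard_le_mul_tsum_of_subset_iUnion hfin'
        (U := fun c : {c // c ∉ G} => ((ASet W ∩ ((c : quotC) : ℝ) • ASet W) ∩ T • D) \ {0})
        (fun c => (hfin _ Set.inter_subset_left T).sdiff) ?_ (by positivity)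
        (fun c => invNormSq_nonneg c) (hsum.subtype _) (fun c => hbound c T hT)
      rintro x ⟨⟨⟨⟨hxA, hxG⟩, hxV⟩, hxD⟩, hx0⟩
      rw [hW.visiblePoints_eq, Set.mem_sdiff, not_and_not_right] at hxV
      obtain ⟨c, hc⟩ := Set.mem_iUnion.mp (hxV hxA)
      refine Set.mem_iUnion.mpr ⟨⟨c, fun hcG => hxG ?_⟩, ⟨⟨hxA, hc⟩, hxD⟩, hx0⟩
      exact Set.mem_biUnion hcG hc
    have h1' : ((S G ∩ T • D).ncard : ℝ) ≤ (visiblePoints (ASet W) ∩ T • D).ncard +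
        (1 + (((S G \ visiblePoints (ASet W)) ∩ T • D) \ {0}).ncard) := by exact_mod_cast h1
    linarith
  have htail : Tendsto (fun G : Finset quotC =>
      K * (∑' c : {c // c ∉ G}, invNormSq c) / volume.real D) atTop (𝓝 0) := by
    have := (tendsto_tsum_compl_atTop_zero invNormSq).const_mul K
    simpa using this.div_const (volume.real D)
  have hone : Tendsto (fun T : ℝ => 1 / volume.real (T • D)) atTop (𝓝 0) := by
    simp_rw [volume_real_smul]
    exact Tendsto.const_div_atTop
      (Tendsto.atTop_mul_const hD0' (tendsto_pow_atTop two_ne_zero)) _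
  rw [Metric.tendsto_nhds]
  intro ε hε
  have hε4 : 0 < ε / 4 := by positivity
  obtain ⟨G, hG1, hG2⟩ := ((Metric.tendsto_nhds.mp htail _ hε4).and
    (Metric.tendsto_nhds.mp hθ _ hε4)).exists
  filter_upwards [Metric.tendsto_nhds.mp hone _ hε4,
    Metric.tendsto_nhds.mp ((hSd G).2 D hD hD0) _ hε4, eventually_gt_atTop 0] with T hT1 hT2 hT
  have hvol : 0 < volume.real (T • D) := by
    rw [volume_real_smul]
    positivity
  have hle : ((visiblePoints (ASet W) ∩ T • D).ncard : ℝ) ≤ (S G ∩ T • D).ncard :=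
    Nat.cast_le.mpr (Set.ncard_le_ncard (Set.inter_subset_inter_left _ (hVS G))
      (hfin _ (fun x hx => hx.1) T))
  have hle' := (div_le_div_iff_of_pos_right hvol).mpr hle
  have hge := (div_le_div_iff_of_pos_right hvol).mpr (hdiff G T hT)
  rw [add_div, add_div] at hge
  have heq : K * T ^ 2 * (∑' c : {c // c ∉ G}, invNormSq c) / volume.real (T • D) =
      K * (∑' c : {c // c ∉ G}, invNormSq c) / volume.real D := by
    rw [volume_real_smul]
    field_simp
  rw [heq] at hge
  rw [Real.dist_eq, abs_lt] at hG1 hG2 hT1 hT2 ⊢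
  constructor <;> linarith [hG1.1, hG1.2, hG2.1, hG2.2, hT1.1, hT1.2, hT2.1, hT2.2]

/-! ### The Dedekind zeta value at 2 as a sum over ideals. -/

section DedekindZeta

variable (K : Type*) [Field K] [NumberField K]

/-- The number of ideals of a given norm. -/
noncomputable def idealCount (n : ℕ) : ℕ := Nat.card {I : Ideal (𝓞 K) // Ideal.absNorm I = n}

theorem tendsto_sum_idealCount_div :
    Tendsto (fun n : ℕ => (∑ k ∈ Finset.Icc 1 n, (idealCount K k : ℝ)) / n) atTop
      (𝓝 (dedekindZeta_residue K)) := by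
  refine ((Ideal.tendsto_norm_le_div_atTop₀ K).comp tendsto_natCast_atTop_atTop).congr fun n ↦ ?_
  simp only [idealCount, Function.comp_apply, Nat.cast_le, ← Nat.cast_sum]
  congr
  -- The zero ideal, the only one of norm 0, accounts for the shift by 1.
  rw [← add_left_inj 1, ← Ideal.card_norm_le_eq_card_norm_le_add_one,
    show Finset.Icc 1 n = Finset.Ioc 0 n from Finset.Icc_succ_left_eq_Ioc _ _,
    show 1 = Nat.card {I : Ideal (𝓞 K) // Ideal.absNorm I = 0} by
      simp [Ideal.absNorm_eq_zero_iff],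
    Finset.sum_Ioc_add_eq_sum_Icc (n.zero_le),
    ← Finset.card_preimage_eq_sum_card_image_eq (fun k _ ↦ Ideal.finite_setOfPred_absNorm_eq k)]
  simp [Set.coe_eq_subtype]

/-- Ideals are counted with positive asymptotic density, so the partial sums of the coefficients are
`O(n)`. -/
theorem LSeriesSummable_idealCount {s : ℂ} (hs : 1 < s.re) :
    LSeriesSummable (fun n => ((idealCount K n : ℝ) : ℂ)) s := by
  refine LSeriesSummable_of_sum_norm_bigO_and_nonneg (r := 1) ?_ (fun n => Nat.cast_nonneg _)
    zero_le_one hs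
  simp_rw [Real.rpow_one]
  refine Asymptotics.isBigO_of_div_tendsto_nhds ?_ _ (tendsto_sum_idealCount_div K)
  filter_upwards [eventually_gt_atTop 0] with n hn h
  exact absurd (Nat.cast_eq_zero.mp h) hn.ne'

theorem tsum_fiber_absNorm (n : ℕ) :
    ∑' I : {I : Ideal (𝓞 K) // Ideal.absNorm I = n}, (((Ideal.absNorm I.1 : ℕ) : ℝ) ^ 2)⁻¹ =
      idealCount K n * ((n : ℝ) ^ 2)⁻¹ := by
  have h (I : {I : Ideal (𝓞 K) // Ideal.absNorm I = n}) :
      (((Ideal.absNorm I.1 : ℕ) : ℝ) ^ 2)⁻¹ = ((n : ℝ) ^ 2)⁻¹ := by rw [I.2]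
  simp_rw [h]
  rw [tsum_const, nsmul_eq_mul, idealCount]

theorem term_idealCount_two (n : ℕ) :
    LSeries.term (fun n => ((idealCount K n : ℝ) : ℂ)) 2 n =
      ((idealCount K n * ((n : ℝ) ^ 2)⁻¹ : ℝ) : ℂ) := by
  rw [LSeries.term_def]
  split_ifs with h
  · simp [h]
  · push_cast
    rw [div_eq_mul_inv]
    norm_num

theorem summable_idealCount_mul : Summable fun n : ℕ => idealCount K n * ((n : ℝ) ^ 2)⁻¹ := by
  have h := LSeriesSummable_idealCount K (s := 2) (by norm_num)
  rw [LSeriesSummable, funext (term_idealCount_two K)] at h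
  exact Complex.summable_ofReal.mp h

theorem summable_sigma_absNorm :
    Summable fun x : (n : ℕ) × {I : Ideal (𝓞 K) // Ideal.absNorm I = n} =>
      (((Ideal.absNorm x.2.1 : ℕ) : ℝ) ^ 2)⁻¹ := by
  rw [summable_sigma_of_nonneg fun x => by positivity]
  refine ⟨fun n => ?_, ?_⟩
  · have : Finite {I : Ideal (𝓞 K) // Ideal.absNorm I = n} := Ideal.finite_setOfPred_absNorm_eq n
    exact Summable.of_finite
  · simp_rw [tsum_fiber_absNorm]
    exact summable_idealCount_mul K

theorem summable_inv_absNorm_sq :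
    Summable fun I : Ideal (𝓞 K) => (((Ideal.absNorm I : ℕ) : ℝ) ^ 2)⁻¹ :=
  (Equiv.sigmaFiberEquiv _).summable_iff.mp (summable_sigma_absNorm K)

/-- Ideals are grouped by norm. The zero ideal is harmless: its term is `0⁻¹ = 0`, as is the term `n
= 0` of the L-series. -/
theorem dedekindZeta_two :
    dedekindZeta K 2 = ((∑' I : Ideal (𝓞 K), (((Ideal.absNorm I : ℕ) : ℝ) ^ 2)⁻¹ : ℝ) : ℂ) := by
  have h1 : dedekindZeta K 2 = LSeries (fun n => ((idealCount K n : ℝ) : ℂ)) 2 := by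
    simp only [dedekindZeta, idealCount, Complex.ofReal_natCast]
  rw [h1, LSeries, funext (term_idealCount_two K), ← Complex.ofReal_tsum]
  congr 1
  rw [← (Equiv.sigmaFiberEquiv fun I : Ideal (𝓞 K) => Ideal.absNorm I).tsum_eq]
  have h2 := (summable_sigma_absNorm K).tsum_sigma' fun n => by
    have : Finite {I : Ideal (𝓞 K) // Ideal.absNorm I = n} := Ideal.finite_setOfPred_absNorm_eq n
    exact Summable.of_finite
  simp_rw [tsum_fiber_absNorm] at h2
  exact h2.symm

end DedekindZeta

/-! ### A finite Euler sieve over ideals. -/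

section Sieve

variable {K : Type*} [Field K] [NumberField K]

open Classical in
/-- Removing the ideals divisible by one more prime multiplies the sum `∑ N(I)⁻²` by an Euler
factor. -/
theorem tsum_coprime_mul {ι : Type*} (p : ι → Ideal (𝓞 K)) (G : Finset ι)
    (hp : ∀ i ∈ G, Prime (p i)) (hpp : ∀ i ∈ G, ∀ j ∈ G, i ≠ j → ¬p i ∣ p j) :
    (∑' I : Ideal (𝓞 K), if ∀ i ∈ G, ¬p i ∣ I then (((Ideal.absNorm I : ℕ) : ℝ) ^ 2)⁻¹ else 0) =
      (∑' I : Ideal (𝓞 K), (((Ideal.absNorm I : ℕ) : ℝ) ^ 2)⁻¹) *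
        ∏ i ∈ G, (1 - (((Ideal.absNorm (p i) : ℕ) : ℝ) ^ 2)⁻¹) := by
  set f : Ideal (𝓞 K) → ℝ := fun I => (((Ideal.absNorm I : ℕ) : ℝ) ^ 2)⁻¹ with hf
  have hfs : Summable f := summable_inv_absNorm_sq K
  have hf0 (I : Ideal (𝓞 K)) : 0 ≤ f I := by positivity
  have hsum (s : Ideal (𝓞 K) → Prop) [DecidablePred s] :
      Summable fun I => if s I then f I else 0 := by
    refine Summable.of_nonneg_of_le (fun I => ?_) (fun I => ?_) hfs
    · split_ifs
      exacts [hf0 I, le_rfl]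
    · split_ifs
      exacts [le_rfl, hf0 I]
  induction G using Finset.induction_on with
  | empty => simp [hf]
  | insert a G ha ih =>
    have ih' := ih (fun i hi => hp i (Finset.mem_insert_of_mem hi)) fun i hi j hj =>
      hpp i (Finset.mem_insert_of_mem hi) j (Finset.mem_insert_of_mem hj)
    have hpa := hp a (Finset.mem_insert_self _ _)
    have hsplit (I : Ideal (𝓞 K)) : (if ∀ i ∈ insert a G, ¬p i ∣ I then f I else 0) =
        (if ∀ i ∈ G, ¬p i ∣ I then f I else 0) -
          (if p a ∣ I ∧ ∀ i ∈ G, ¬p i ∣ I then f I else 0) := by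
      simp only [Finset.forall_mem_insert]
      by_cases h1 : p a ∣ I <;> by_cases h2 : ∀ i ∈ G, ¬p i ∣ I <;> simp [h1, h2]
    -- Substitute `I = p a * J`: the norm is multiplicative, and a prime `p i` that does not divide
    -- `p a` divides `p a * J` only if it divides `J`.
    have hshift : (∑' I, if p a ∣ I ∧ ∀ i ∈ G, ¬p i ∣ I then f I else 0) =
        f (p a) * ∑' I, if ∀ i ∈ G, ¬p i ∣ I then f I else 0 := by
      rw [← (mul_right_injective₀ hpa.ne_zero).tsum_eq, ← tsum_mul_left]
      · refine tsum_congr fun J => ?_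
        have h1 : (p a ∣ p a * J ∧ ∀ i ∈ G, ¬p i ∣ p a * J) ↔ ∀ i ∈ G, ¬p i ∣ J := by
          refine ⟨fun h i hi hiJ => h.2 i hi (hiJ.mul_left _),
            fun h => ⟨Dvd.intro _ rfl, fun i hi hiJ => ?_⟩⟩
          have hi' := Finset.mem_insert_of_mem (a := i) (b := a) hi
          rcases (hp i hi').dvd_or_dvd hiJ with h3 | h3
          · exact hpp i hi' a (Finset.mem_insert_self _ _) (fun h4 => ha (h4 ▸ hi)) h3
          · exact h i hi h3
        have h2 : f (p a * J) = f (p a) * f J := by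
          simp only [hf, map_mul, Nat.cast_mul, mul_pow, mul_inv]
        by_cases h3 : ∀ i ∈ G, ¬p i ∣ J
        · rw [if_pos (h1.mpr h3), if_pos h3, h2]
        · rw [if_neg (h1.not.mpr h3), if_neg h3, mul_zero]
      · intro I hI
        by_contra h
        refine hI (if_neg fun h' => h ?_)
        obtain ⟨J, rfl⟩ := h'.1
        exact ⟨J, rfl⟩
    rw [tsum_congr hsplit, (hsum _).tsum_sub (hsum _), hshift, ih', Finset.prod_insert ha]
    ring

end Sieve

/-! ### The infinite product over `C` and its expansion. -/

instance : IsPrincipalIdealRing (𝓞 QSqrtTwo) :=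
  IsPrincipalIdealRing.of_surjective integersEquiv integersEquiv.surjective

/-- The ideal of the ring of integers of `ℚ(√2)` generated by an element of `C`. -/
noncomputable def quotIdeal (c : quotC) : Ideal (𝓞 QSqrtTwo) :=
  Ideal.span {integersEquiv (quotElem c)}

theorem inv_absNorm_quotIdeal_sq (c : quotC) :
    (((Ideal.absNorm (quotIdeal c) : ℕ) : ℝ) ^ 2)⁻¹ = invNormSq c := by
  rw [quotIdeal, absNorm_span_integersEquiv, invNormSq, Nat.cast_natAbs, Int.cast_abs, sq_abs]

theorem quotIdeal_dvd_iff {c c' : quotC} :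
    quotIdeal c ∣ quotIdeal c' ↔ quotElem c ∣ quotElem c' := by
  rw [quotIdeal, quotIdeal, Ideal.span_singleton_dvd_span_singleton_iff_dvd]
  exact map_dvd_iff integersEquiv

theorem prime_quotIdeal {c : quotC} (hc : (c : ℝ) ≠ lam) : Prime (quotIdeal c) := by
  have hp : Prime (quotElem c) := ((quotElem_cases c).resolve_right fun h => hc h.2).1
  have hp' : Prime (integersEquiv (quotElem c)) := (MulEquiv.prime_iff integersEquiv).mpr hp
  refine Ideal.prime_of_isPrime ?_ ((Ideal.span_singleton_prime hp'.ne_zero).mpr hp')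
  rw [quotIdeal, Ne, Ideal.span_singleton_eq_bot]
  exact hp'.ne_zero

theorem not_quotIdeal_dvd {c c' : quotC} (hc : (c : ℝ) ≠ lam) (h : c ≠ c') :
    ¬quotIdeal c ∣ quotIdeal c' := by
  rw [quotIdeal_dvd_iff]
  intro hdvd
  have hp : Prime (quotElem c) := ((quotElem_cases c).resolve_right fun h => hc h.2).1
  exact hp.not_isUnit ((isCoprime_quotElem h).isUnit_of_dvd' dvd_rfl hdvd)

theorem quotIdeal_injective : Function.Injective quotIdeal := by
  intro c c' h
  by_contra hne
  by_cases hc : (c : ℝ) = lam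
  · have hc' : (c' : ℝ) ≠ lam := fun h' => hne (Subtype.ext (hc.trans h'.symm))
    exact not_quotIdeal_dvd hc' (Ne.symm hne) h.symm.dvd
  · exact not_quotIdeal_dvd hc hne h.dvd

/-- Distinct elements of `C` generate distinct ideals (`lam` the unit ideal), so this is a subfamily
of the sum over ideals. -/
theorem summable_invNormSq : Summable invNormSq :=
  ((summable_inv_absNorm_sq QSqrtTwo).comp_injective quotIdeal_injective).congr
    inv_absNorm_quotIdeal_sq

theorem exists_quotIdeal_dvd {I : Ideal (𝓞 QSqrtTwo)} (h0 : I ≠ ⊥) (h1 : I ≠ ⊤) :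
    ∃ c : quotC, (c : ℝ) ≠ lam ∧ quotIdeal c ∣ I := by
  obtain ⟨x, rfl⟩ := (IsPrincipalIdealRing.principal I).principal
  obtain ⟨b, rfl⟩ := integersEquiv.surjective x
  have hb0 : b ≠ 0 := by
    rintro rfl
    exact h0 (by simp)
  have hb : ¬IsUnit b := fun h => h1 (Ideal.span_singleton_eq_top.mpr (h.map integersEquiv))
  obtain ⟨p, hp, hpb, hp1, hp2⟩ := exists_prime_dvd_emb_mem_primesP hb0 hb
  have hmem : emb p ∈ quotC := Or.inl (mem_primesP.mpr ⟨p, hp, rfl, hp1, hp2⟩)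
  refine ⟨⟨emb p, hmem⟩, hp2.ne, ?_⟩
  have hq : quotElem ⟨emb p, hmem⟩ = p := emb_injective (emb_quotElem _)
  rw [quotIdeal, hq]
  exact Ideal.span_singleton_dvd_span_singleton_iff_dvd.mpr (map_dvd integersEquiv hpb)

/-- The sum `∑ N(I)⁻²` over the ideals of the ring of integers of `ℚ(√2)`. -/
noncomputable def zetaTwo : ℝ :=
  ∑' I : Ideal (𝓞 QSqrtTwo), (((Ideal.absNorm I : ℕ) : ℝ) ^ 2)⁻¹

theorem zetaTwo_pos : 0 < zetaTwo :=
  (summable_inv_absNorm_sq QSqrtTwo).tsum_pos (fun I => by positivity) ⊤ (by simp)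

/-- The Euler product as a sieve: the left side sums `N(I)⁻²` over the ideals prime to `G`. As `G`
grows only the unit ideal survives, and the full sum dominates. -/
theorem tendsto_zetaTwo_mul_prod :
    Tendsto (fun G : Finset quotC =>
      zetaTwo * ∏ c ∈ G.erase ⟨lam, lam_mem_quotC⟩, (1 - invNormSq c)) atTop (𝓝 1) := by
  classical
  set f : Ideal (𝓞 QSqrtTwo) → ℝ := fun I => (((Ideal.absNorm I : ℕ) : ℝ) ^ 2)⁻¹ with hf
  have hne {G : Finset quotC} {c : quotC} (hc : c ∈ G.erase ⟨lam, lam_mem_quotC⟩) :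
      (c : ℝ) ≠ lam := fun h => (Finset.mem_erase.mp hc).1 (Subtype.ext h)
  have heq (G : Finset quotC) :
      zetaTwo * ∏ c ∈ G.erase ⟨lam, lam_mem_quotC⟩, (1 - invNormSq c) =
        ∑' I, if ∀ c ∈ G.erase ⟨lam, lam_mem_quotC⟩, ¬quotIdeal c ∣ I then f I else 0 := by
    simp_rw [← inv_absNorm_quotIdeal_sq]
    rw [zetaTwo]
    convert (tsum_coprime_mul quotIdeal (G.erase ⟨lam, lam_mem_quotC⟩)
      (fun c hc => prime_quotIdeal (hne hc)) fun c hc c' _ h => not_quotIdeal_dvd (hne hc) h).symm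
  simp_rw [heq]
  have hlim : (∑' I : Ideal (𝓞 QSqrtTwo), if I = ⊤ then (1 : ℝ) else 0) = 1 := by
    rw [tsum_ite_eq]
  rw [← hlim]
  refine tendsto_tsum_of_dominated_convergence (summable_inv_absNorm_sq QSqrtTwo) (fun I => ?_)
    (Eventually.of_forall fun G I => ?_)
  · by_cases h1 : I = ⊤
    · subst h1
      rw [if_pos rfl]
      refine tendsto_const_nhds.congr fun G => ?_
      rw [if_pos]
      · simp [hf]
      · intro c hc h
        rw [← Ideal.one_eq_top] at h
        exact (prime_quotIdeal (hne hc)).not_isUnit (isUnit_of_dvd_one h)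
    · rw [if_neg h1]
      -- The zero ideal has weight `0⁻¹ = 0`, whatever divides it.
      by_cases h0 : I = ⊥
      · subst h0
        refine tendsto_const_nhds.congr fun G => ?_
        simp [hf]
      · obtain ⟨c, hc, hcI⟩ := exists_quotIdeal_dvd h0 h1
        refine tendsto_const_nhds.congr' ?_
        filter_upwards [eventually_ge_atTop {c}] with G hG
        rw [if_neg]
        intro h
        refine h c (Finset.mem_erase.mpr ⟨fun h => hc (congrArg Subtype.val h), ?_⟩) hcI
        exact hG (Finset.mem_singleton_self c)
  · split_ifs
    · rw [Real.norm_of_nonneg (by positivity)]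
    · rw [norm_zero]
      positivity

theorem quotFactor_eq_invNormSq {c : quotC} (hc : (c : ℝ) ≠ lam) : quotFactor c = invNormSq c := by
  rw [quotFactor, if_neg hc, invNormSq]

theorem tendsto_prod_one_sub_quotFactor :
    Tendsto (fun G : Finset quotC => ∏ c ∈ G, (1 - quotFactor c)) atTop
      (𝓝 ((1 - (lam ^ 2)⁻¹) / zetaTwo)) := by
  classical
  have h := tendsto_zetaTwo_mul_prod.const_mul ((1 - (lam ^ 2)⁻¹) / zetaTwo)
  rw [mul_one] at h
  refine h.congr' ?_
  filter_upwards [eventually_ge_atTop {⟨lam, lam_mem_quotC⟩}] with G hG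
  have hmem : (⟨lam, lam_mem_quotC⟩ : quotC) ∈ G := hG (Finset.mem_singleton_self _)
  rw [← Finset.mul_prod_erase G _ hmem]
  have h1 : quotFactor ⟨lam, lam_mem_quotC⟩ = (lam ^ 2)⁻¹ := if_pos rfl
  have h2 : ∏ c ∈ G.erase ⟨lam, lam_mem_quotC⟩, (1 - quotFactor c) =
      ∏ c ∈ G.erase ⟨lam, lam_mem_quotC⟩, (1 - invNormSq c) :=
    Finset.prod_congr rfl fun c hc => by
      rw [quotFactor_eq_invNormSq fun h => (Finset.mem_erase.mp hc).1 (Subtype.ext h)]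
  rw [h1, h2]
  have := zetaTwo_pos.ne'
  field_simp

theorem quotFactor_nonneg (c : quotC) : 0 ≤ quotFactor c := by
  rw [quotFactor]
  split_ifs <;> positivity

theorem summable_quotFactor : Summable quotFactor := by
  refine Summable.of_nonneg_of_le quotFactor_nonneg (fun c => ?_) summable_invNormSq
  by_cases hc : (c : ℝ) = lam
  · rw [quotFactor, if_pos hc, invNormSq]
    rcases quotElem_cases c with ⟨-, h⟩ | ⟨h, -⟩
    · exact absurd hc h.ne
    · rw [h]
      have h2 : ((lamUnit : ℤ√2).norm : ℝ) ^ 2 = 1 := by norm_num [lamUnit, Zsqrtd.norm_def]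
      rw [h2, inv_one]
      exact inv_le_one_of_one_le₀ (one_le_pow₀ one_lt_lam.le)
  · exact (quotFactor_eq_invNormSq hc).le

/-- Summability of `quotFactor` allows `∏ (1 - quotFactor c)` to be expanded into an absolutely
convergent sum over finite subsets; its value is the limit of the partial products. -/
theorem hasSum_neg_one_pow_mul_prod_quotFactor :
    HasSum (fun F : Finset quotC => (-1 : ℝ) ^ F.card * ∏ c ∈ F, quotFactor c)
      ((1 - (lam ^ 2)⁻¹) / zetaTwo) := by
  have h1 : Summable fun F : Finset quotC => ∏ c ∈ F, -quotFactor c :=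
    summable_finsetProd_of_summable_norm (by simpa using summable_quotFactor.norm)
  have h2 := hasProd_one_add_of_hasSum_prod h1.hasSum
  rw [HasProd, SummationFilter.unconditional_filter] at h2
  simp_rw [← sub_eq_add_neg] at h2
  have h3 := tendsto_nhds_unique h2 tendsto_prod_one_sub_quotFactor
  have h4 := h1.hasSum
  rw [h3] at h4
  simpa only [Finset.prod_neg] using h4

/-! ### The octagon: window conditions and area. -/

theorem mem_octagon {z : ℂ} : z ∈ octagon ↔
    z.re ∈ Set.Ioo (-(lam / 2)) (lam / 2) ∧
      z.im ∈ Set.Ioo (-min (lam / 2) (lam / 2 + 1 / 2 - |z.re|))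
        (min (lam / 2) (lam / 2 + 1 / 2 - |z.re|)) := by
  have hs : √2 * √2 = 2 := Real.mul_self_sqrt (by norm_num)
  have h4 : zeta8 ^ 4 = -1 := by
    rw [show (4 : ℕ) = 2 * 2 by norm_num, pow_mul, zeta8_sq_eq_I, Complex.I_sq]
  have h5 : zeta8 ^ 5 = -zeta8 := by rw [pow_succ, h4]; ring
  have h6 : zeta8 ^ 6 = -Complex.I := by
    rw [show 6 = 4 + 2 by norm_num, pow_add, h4, zeta8_sq_eq_I]; ring
  have h7 : zeta8 ^ 7 = -zeta8 ^ 3 := by rw [show 7 = 4 + 3 by norm_num, pow_add, h4]; ring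
  have e : octagon = {z | ∀ k : Fin 8, (z * (starRingEnd ℂ) (zeta8 ^ (k : ℕ))).re < lam / 2} := rfl
  -- The diagonal sides need `lam / √2 = lam / 2 + 1 / 2`.
  have key (u : ℝ) : √2 / 2 * u < lam / 2 ↔ u < lam / 2 + 1 / 2 := by
    have h : lam / 2 = √2 / 2 * (lam / 2 + 1 / 2) := by
      rw [lam]
      linear_combination -1 / 4 * hs
    rw [h, mul_lt_mul_iff_right₀ (by positivity), ← h]
  have k1 := key (z.re + z.im)
  have k2 := key (-z.re + z.im)
  have k3 := key (-z.re - z.im)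
  have k4 := key (z.re - z.im)
  have hre (x y : ℝ) : (z * (starRingEnd ℂ) (x + y * Complex.I)).re = z.re * x + z.im * y := by
    simp
  have m0 : (z * (starRingEnd ℂ) (zeta8 ^ 0)).re = z.re := by simp
  have m1 : (z * (starRingEnd ℂ) (zeta8 ^ 1)).re = √2 / 2 * (z.re + z.im) := by
    rw [pow_one, zeta8_eq, hre]; ring
  have m2 : (z * (starRingEnd ℂ) (zeta8 ^ 2)).re = z.im := by simp [zeta8_sq_eq_I]
  have m3 : (z * (starRingEnd ℂ) (zeta8 ^ 3)).re = √2 / 2 * (-z.re + z.im) := by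
    have : zeta8 ^ 3 = ((-(√2 / 2) : ℝ) : ℂ) + ((√2 / 2 : ℝ) : ℂ) * Complex.I := by
      rw [zeta8_pow_three]; push_cast; ring
    rw [this, hre]; ring
  have m4 : (z * (starRingEnd ℂ) (zeta8 ^ 4)).re = -z.re := by simp [h4]
  have m5 : (z * (starRingEnd ℂ) (zeta8 ^ 5)).re = √2 / 2 * (-z.re - z.im) := by
    rw [pow_one] at m1
    rw [h5, map_neg, mul_neg, Complex.neg_re, m1]; ring
  have m6 : (z * (starRingEnd ℂ) (zeta8 ^ 6)).re = -z.im := by simp [h6]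
  have m7 : (z * (starRingEnd ℂ) (zeta8 ^ 7)).re = √2 / 2 * (z.re - z.im) := by
    rw [h7, map_neg, mul_neg, Complex.neg_re, m3]; ring
  have hall : z ∈ octagon ↔ z.re < lam / 2 ∧ z.re + z.im < lam / 2 + 1 / 2 ∧ z.im < lam / 2 ∧
      -z.re + z.im < lam / 2 + 1 / 2 ∧ -z.re < lam / 2 ∧ -z.re - z.im < lam / 2 + 1 / 2 ∧
      -z.im < lam / 2 ∧ z.re - z.im < lam / 2 + 1 / 2 := by
    rw [← k1, ← k2, ← k3, ← k4, ← m1, ← m3, ← m5, ← m7, ← m4, ← m6, e, Set.mem_ofPred_eq]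
    constructor
    · intro h
      exact ⟨m0 ▸ h 0, h 1, m2 ▸ h 2, h 3, h 4, h 5, h 6, h 7⟩
    · rintro ⟨g0, g1, g2, g3, g4, g5, g6, g7⟩ k
      fin_cases k
      exacts [m0.symm ▸ g0, g1, m2.symm ▸ g2, g3, g4, g5, g6, g7]
  rw [hall, Set.mem_Ioo, Set.mem_Ioo, neg_lt (b := z.im), lt_min_iff, lt_min_iff]
  constructor
  · rintro ⟨g0, g1, g2, g3, g4, g5, g6, g7⟩
    refine ⟨⟨by linarith, g0⟩, ⟨g6, ?_⟩, g2, ?_⟩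
    · rcases abs_cases z.re with ⟨h, -⟩ | ⟨h, -⟩ <;> rw [h] <;> linarith
    · rcases abs_cases z.re with ⟨h, -⟩ | ⟨h, -⟩ <;> rw [h] <;> linarith
  · rintro ⟨⟨g4, g0⟩, ⟨g6, ga⟩, g2, gb⟩
    have h1 := le_abs_self z.re
    have h2 := neg_le_abs z.re
    refine ⟨g0, ?_, g2, ?_, ?_, ?_, g6, ?_⟩ <;> linarith

theorem octagon_convex : Convex ℝ octagon := by
  have : octagon = ⋂ k : Fin 8,
      {z : ℂ | (z * (starRingEnd ℂ) (zeta8 ^ (k : ℕ))).re < (1 + √2) / 2} := by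
    ext z
    simp [octagon]
  rw [this]
  refine convex_iInter fun k => convex_halfSpace_lt ⟨fun x y => ?_, fun c x => ?_⟩ _
  · rw [add_mul, Complex.add_re]
  · rw [smul_mul_assoc, Complex.smul_re]

theorem zero_mem_octagon : (0 : ℂ) ∈ octagon := by
  intro k
  simp only [zero_mul, Complex.zero_re]
  positivity

theorem neg_mem_octagon {z : ℂ} (hz : z ∈ octagon) : -z ∈ octagon := by
  rw [mem_octagon] at hz ⊢
  rw [Complex.neg_re, Complex.neg_im, abs_neg]
  obtain ⟨⟨h1, h2⟩, h3, h4⟩ := hz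
  exact ⟨⟨by linarith, by linarith⟩, by linarith, by linarith⟩

theorem octagon_isBounded : Bornology.IsBounded octagon := by
  refine (Metric.isBounded_closedBall (x := (0 : ℂ)) (r := lam)).subset fun z hz => ?_
  obtain ⟨⟨h1, h2⟩, h3, h4⟩ := mem_octagon.mp hz
  have h5 := min_le_left (lam / 2) (lam / 2 + 1 / 2 - |z.re|)
  rw [mem_closedBall_zero_iff]
  refine (Complex.norm_le_abs_re_add_abs_im z).trans ?_
  have h6 : |z.re| ≤ lam / 2 := abs_le.mpr ⟨by linarith, by linarith⟩
  have h7 : |z.im| ≤ lam / 2 := abs_le.mpr ⟨by linarith, by linarith⟩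
  linarith

theorem isWindow_octagon : IsWindow octagon := by
  have hstar : StarConvex ℝ 0 octagon := octagon_convex.starConvex zero_mem_octagon
  refine ⟨⟨octagon_isBounded, octagon_convex.addHaar_frontier _⟩, hstar, fun z hz => ?_⟩
  have hz' : z ∈ octagon := by simpa using neg_mem_octagon hz
  have hs : √2 ≠ 0 := by positivity
  refine ⟨(√2)⁻¹ • z, hstar.smul_mem hz' (by positivity) ?_, smul_inv_smul₀ hs z⟩
  exact inv_le_one_of_one_le₀ (by linarith [sqrt_two_bounds.1])

theorem integral_min_octagon {a : ℝ} (ha : 1 / 2 ≤ a) :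
    ∫ x in (-a)..a, min a (a + 1 / 2 - |x|) = a ^ 2 + a - 1 / 4 := by
  have hc : Continuous fun x : ℝ => min a (a + 1 / 2 - |x|) := by fun_prop
  have hi (u v : ℝ) : IntervalIntegrable (fun x : ℝ => min a (a + 1 / 2 - |x|)) volume u v :=
    hc.intervalIntegrable u v
  -- The minimum changes branch at `|x| = 1/2`, the ends of the horizontal sides of length 1.
  rw [← intervalIntegral.integral_add_adjacent_intervals (hi (-a) (-(1 / 2))) (hi _ _),
    ← intervalIntegral.integral_add_adjacent_intervals (hi (-(1 / 2)) (1 / 2)) (hi _ _)]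
  have h1 : ∫ x in (-a)..(-(1 / 2)), min a (a + 1 / 2 - |x|) =
      ∫ x in (-a)..(-(1 / 2)), (a + 1 / 2 + x) := by
    refine intervalIntegral.integral_congr fun x hx => ?_
    rw [Set.uIcc_of_le (by linarith)] at hx
    rw [abs_of_nonpos (by linarith [hx.2]), min_eq_right (by linarith [hx.2])]
    ring
  have h2 : ∫ x in (-(1 / 2))..(1 / 2), min a (a + 1 / 2 - |x|) =
      ∫ x in (-(1 / 2 : ℝ))..(1 / 2), a := by
    refine intervalIntegral.integral_congr fun x hx => ?_
    rw [Set.uIcc_of_le (by norm_num)] at hx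
    have := abs_le.mpr hx
    rw [min_eq_left (by linarith)]
  have h3 : ∫ x in (1 / 2)..a, min a (a + 1 / 2 - |x|) =
      ∫ x in (1 / 2)..a, (a + 1 / 2 - x) := by
    refine intervalIntegral.integral_congr fun x hx => ?_
    rw [Set.uIcc_of_le (by linarith)] at hx
    rw [abs_of_nonneg (by linarith [hx.1]), min_eq_right (by linarith [hx.1])]
  rw [h1, h2, h3, intervalIntegral.integral_add (by simp) (by simp),
    intervalIntegral.integral_sub (by simp) (by simp)]
  simp only [intervalIntegral.integral_const, integral_id, smul_eq_mul]
  ring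

theorem volume_real_octagon : volume.real octagon = 2 * lam := by
  have hl : 1 / 2 ≤ lam / 2 := by linarith [one_lt_lam]
  have hs : √2 * √2 = 2 := Real.mul_self_sqrt (by norm_num)
  set g : ℝ → ℝ := fun x => min (lam / 2) (lam / 2 + 1 / 2 - |x|) with hg
  have hgc : Continuous g := by fun_prop
  have hpre : octagon = Complex.measurableEquivRealProd ⁻¹'
      (regionBetween (-g) g (Set.Ioo (-(lam / 2)) (lam / 2))) := by
    ext z
    rw [mem_octagon]
    rfl
  have hm : MeasurableSet (regionBetween (-g) g (Set.Ioo (-(lam / 2)) (lam / 2))) :=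
    measurableSet_regionBetween hgc.neg.measurable hgc.measurable measurableSet_Ioo
  have hint : IntegrableOn g (Set.Ioo (-(lam / 2)) (lam / 2)) :=
    (hgc.integrableOn_Icc).mono_set Set.Ioo_subset_Icc_self
  have hg0 (x : ℝ) (hx : x ∈ Set.Ioo (-(lam / 2)) (lam / 2)) : 0 ≤ g x := by
    have : |x| < lam / 2 := abs_lt.mpr hx
    exact le_min (by linarith) (by linarith)
  have hvol : volume octagon = ENNReal.ofReal (∫ x in Set.Ioo (-(lam / 2)) (lam / 2),
      (g - -g) x) := by
    rw [hpre, Complex.volume_preserving_equiv_real_prod.measure_preimage hm.nullMeasurableSet,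
      Measure.volume_eq_prod]
    exact volume_regionBetween_eq_integral hint.neg hint measurableSet_Ioo fun x hx => by
      have := hg0 x hx
      simp only [Pi.neg_apply]
      linarith
  have hI : ∫ x in Set.Ioo (-(lam / 2)) (lam / 2), (g - -g) x = 2 * lam := by
    have h2 (x : ℝ) : (g - -g) x = 2 * g x := by
      simp only [Pi.sub_apply, Pi.neg_apply]
      ring
    simp_rw [h2]
    rw [integral_const_mul, ← integral_Ioc_eq_integral_Ioo,
      ← intervalIntegral.integral_of_le (by linarith), integral_min_octagon hl, lam]
    linear_combination 1 / 2 * hs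
  rw [measureReal_def, hvol, hI, ENNReal.toReal_ofReal (by linarith [one_lt_lam])]

/-! ### Assembly. -/

/-- Equivalent to `lam² = 2 lam + 1`. Together with `norm_sigma_lamZ` it turns the factor of `lam`
in the product into `2 |σ λ|`. -/
theorem one_sub_inv_lam_sq : 1 - (lam ^ 2)⁻¹ = 2 * lam⁻¹ := by
  have hs : √2 * √2 = 2 := Real.mul_self_sqrt (by norm_num)
  have hl : lam ≠ 0 := (one_pos.trans one_lt_lam).ne'
  field_simp
  rw [lam]
  linear_combination hs

theorem norm_sigma_lamZ : ‖((sigma lamZ : QZeta) : ℂ)‖ = lam⁻¹ := by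
  have hs : √2 * √2 = 2 := Real.mul_self_sqrt (by norm_num)
  rw [coe_sigma_lamZ, Complex.norm_real, Real.norm_eq_abs,
    abs_of_nonpos (by linarith [sqrt_two_bounds.1])]
  refine eq_inv_of_mul_eq_one_left ?_
  rw [lam]
  linear_combination hs

theorem IsWindow.hasDensity_visiblePoints {W : Set ℂ} (hW : IsWindow W) :
    HasDensity (visiblePoints (ASet W)) (2 * lam⁻¹ * (volume.real W / 4) / zetaTwo) := by
  refine _root_.hasDensity_visiblePoints hW summable_invNormSq ?_
  convert tendsto_prod_one_sub_quotFactor.const_mul (volume.real W / 4) using 2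
  rw [one_sub_inv_lam_sq]
  ring

theorem mainTheorem1 :
    (∀ W : Set ℂ, IsWindow W →
      IsOcclusionQuotients quotC (ASet W) ∧
      ∃ (θA θvis : ℝ) (θF : Finset quotC → ℝ),
        HasDensity (ASet W) θA ∧
        HasDensity (visiblePoints (ASet W)) θvis ∧
        (∀ F : Finset quotC, HasDensity (multiIntersection (ASet W) F) (θF F)) ∧
        HasSum (fun F : Finset quotC => (-1 : ℝ) ^ F.card * θF F) θvis ∧
        (θvis : ℂ) =
          2 * ((‖((sigma lamZ : QZeta) : ℂ)‖ : ℝ) : ℂ) * (θA : ℂ) /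
            NumberField.dedekindZeta QSqrtTwo 2) ∧
    (∃ θ : ℝ, HasDensity (visiblePoints (ASet octagon)) θ ∧
      (θ : ℂ) = 1 / NumberField.dedekindZeta QSqrtTwo 2) := by
  have hzeta : NumberField.dedekindZeta QSqrtTwo 2 = (zetaTwo : ℂ) := dedekindZeta_two QSqrtTwo
  refine ⟨fun W hW => ⟨hW.isOcclusionQuotients, volume.real W / 4,
    2 * lam⁻¹ * (volume.real W / 4) / zetaTwo,
    fun F => volume.real W / 4 * ∏ c ∈ F, quotFactor c, hasDensity_ASet hW.1,
    hW.hasDensity_visiblePoints, hasDensity_multiIntersection hW, ?_, ?_⟩, ?_⟩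
  · have h := hasSum_neg_one_pow_mul_prod_quotFactor.mul_left (volume.real W / 4)
    have e : volume.real W / 4 * ((1 - (lam ^ 2)⁻¹) / zetaTwo) =
        2 * lam⁻¹ * (volume.real W / 4) / zetaTwo := by
      rw [one_sub_inv_lam_sq]
      ring
    rw [e] at h
    exact (funext fun F => mul_left_comm _ _ _ : (fun F : Finset quotC =>
      (-1 : ℝ) ^ F.card * (volume.real W / 4 * ∏ c ∈ F, quotFactor c)) = _) ▸ h
  · rw [hzeta, norm_sigma_lamZ]
    push_cast
    rfl
  · refine ⟨_, isWindow_octagon.hasDensity_visiblePoints, ?_⟩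
    -- The area `2 * lam` cancels `2 * lam⁻¹ / 4` exactly.
    have h : 2 * lam⁻¹ * (volume.real octagon / 4) / zetaTwo = 1 / zetaTwo := by
      have hl : lam ≠ 0 := (one_pos.trans one_lt_lam).ne'
      rw [volume_real_octagon]
      field_simp
      norm_num
    rw [h, hzeta]
    push_cast
    rfl
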